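/- Let $M=(Q,\Sigma,b,\delta,q_0,F)$ be a deterministic one-tape Turing machine with $Q=\{0,\dots,m'-1\}$, $\Sigma=\{0,\dots,k-2\}$, blank $b=0$, and $\delta:Q\times\Sigma\to Q\times\Sigma\times\{L,R\}$; in a final state (a state of $F$) its configuration no longer changes. A configuration $c$ consists of the state $q$, the scanned symbol $s$, and the contents $x_0x_1\dots$ and $y_0y_1\dots$ of the tape to the left and to the right of the head (read away from the head, all but finitely many cells blank). Its rational encoding is $[c]=(0.x,\,s,\,0.y,\,q)\in\mathbb R^4$ with $0.x=\sum_i x_ik^{-i-1}$ and $0.y=\sum_i y_ik^{-i-1}$. Its space is the length of the shortest tape segment that contains the head and all nonblank cells. For a finite word $e$ over $\Sigma$, let $c_n(e)$ be the configuration of $M$ on input $e$ after $n$ steps; in $c_0(e)$ the head scans the first letter of $e$. Let $S(e)$ be the maximum of the spaces of all $c_n(e)$, possibly infinite. **Theorem.** For every such $M$ there are $m\in\mathbb N$, a vector $p$ of $4+m$ real polynomials in $4+m$ variables, a map $\psi:\mathbb R^2\to\mathbb R^m$ each coordinate of which has the form $a(S,T)\,e^{b(S,T)}$ with real polynomials $a,b$,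 and a real polynomial $P$ in one variable such that the following holds for all inputs $e$, all real $T\ge 0$ and all $S\in\mathbb N$ such that $c_n(e)$ has space at most $S$ for every integer $0\le n\le T$ (for instance $S=S(e)$, if $S(e)<\infty$). The initial value problem $$y'=p(y),\qquad y(0)=\bigl([c_0(e)],\,\psi(S,T)\bigr)$$ has exactly one solution $y$ on $[0,T]$, and 1. for every integer $0\le n\le T$, the first four coordinates of $y(n)$ fully and unambiguously describe $c_n(e)$: their distance to $[c_n(e)]$ in the maximum norm is at most $\tfrac14k^{-S}$, and $c_n(e)$ is the only configuration of space at most $S$ with this property; 2. $\|y(t)\|_\infty\le P(S+T)$ for all $0\le t\le T$. -/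

import Mathlib

namespace GPACSim

/-- A one-tape deterministic Turing machine `(Q, Σ, b, δ, q₀, F)` with `Q = {0, …, states - 1}`,
`Σ = {0, …, nonblank}` and blank symbol `b = 0`. -/
structure Machine where
  /-- The number of states. -/
  states : ℕ
  /-- The number of symbols other than the blank. -/
  nonblank : ℕ
  /-- The transition function: new state, symbol written, direction of the move. -/
  trans : Fin states → Fin (nonblank + 1) → Fin states × Fin (nonblank + 1) × Turing.Dir
  /-- The initial state. -/
  start : Fin states
  /-- The final states, in which the machine does not move any more. -/
  final : Finset (Fin states)

/-- The length of a half tape: the least `n` such that all cells from the `n`-th on are blank. -/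
noncomputable def halfLength {r : ℕ} (L : Turing.ListBlank (Fin (r + 1))) : ℕ :=
  sInf {n | ∀ i, n ≤ i → L.nth i = default}

/-- Only finitely many cells of a half tape are not blank. -/
theorem halfLength_set_nonempty {r : ℕ} (L : Turing.ListBlank (Fin (r + 1))) :
    {n | ∀ i, n ≤ i → L.nth i = default}.Nonempty := by
  induction L using Turing.ListBlank.induction_on with
  | h l =>
    refine ⟨l.length, fun i hi => ?_⟩
    rw [Turing.ListBlank.nth_mk]
    exact List.getI_eq_default l hi

/-- The number `0.x = x₀ k⁻¹ + x₁ k⁻² + ⋯` of a half tape `x₀ x₁ …`, the cell next to the head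
being first. (Only finitely many terms are nonzero.) -/
noncomputable def fraction (k : ℕ) {r : ℕ} (L : Turing.ListBlank (Fin (r + 1))) : ℝ :=
  ∑' i : ℕ, ((L.nth i : ℕ) : ℝ) / (k : ℝ) ^ (i + 1)

namespace Machine

variable (M : Machine)

/-- The tape alphabet. -/
abbrev Symbol : Type := Fin (M.nonblank + 1)

/-- The base `k` of the encoding: one more than the number of symbols, so `Σ = {0, …, k - 2}`. -/
def base : ℕ := M.nonblank + 2

/-- A configuration: the current state and the tape, seen from the head. -/
structure Config where
  /-- The current state. -/
  state : Fin M.states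
  /-- The two-way infinite tape, all but finitely many cells of which are blank. -/
  tape : Turing.Tape M.Symbol

/-- The initial configuration on input `e`: the head scans the first letter of `e`, and all cells
that do not belong to `e` are blank. -/
def init (e : List M.Symbol) : M.Config := ⟨M.start, Turing.Tape.mk₁ e⟩

/-- One step of the machine. In a final state nothing changes. -/
def step (c : M.Config) : M.Config :=
  if c.state ∈ M.final then c
  else
    ⟨(M.trans c.state c.tape.head).1,
      Turing.Tape.move (M.trans c.state c.tape.head).2.2
        (c.tape.write (M.trans c.state c.tape.head).2.1)⟩

/-- The configuration on input `e` after `n` steps. -/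
def run (e : List M.Symbol) (n : ℕ) : M.Config := M.step^[n] (M.init e)

/-- The space of a configuration: the length of the shortest segment of the tape that contains the
head and all nonblank cells. -/
noncomputable def space (c : M.Config) : ℕ :=
  halfLength c.tape.left + 1 + halfLength c.tape.right

/-- The space `S(e)` used by the machine on input `e`. -/
noncomputable def spaceUsed (e : List M.Symbol) : ℕ∞ := ⨆ n : ℕ, (M.space (M.run e n) : ℕ∞)

/-- Up to time `T`, the machine on input `e` uses at most space `S`. -/
def RunsInSpace (e : List M.Symbol) (T : ℝ) (S : ℕ) : Prop :=
  ∀ n : ℕ, (n : ℝ) ≤ T → M.space (M.run e n) ≤ S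

/-- In particular one may take `S = S(e)`, whenever this is finite. -/
theorem runsInSpace_of_spaceUsed_eq (e : List M.Symbol) (T : ℝ) (S : ℕ)
    (h : M.spaceUsed e = S) : M.RunsInSpace e T S := by
  intro n _
  have h1 : (M.space (M.run e n) : ℕ∞) ≤ M.spaceUsed e :=
    le_iSup (fun n : ℕ => (M.space (M.run e n) : ℕ∞)) n
  rw [h] at h1
  exact_mod_cast h1

/-- The rational encoding `[c] = (0.x, s, 0.y, q)` of a configuration: left half of the tape,
scanned symbol, right half of the tape, state. -/
noncomputable def encode (c : M.Config) : Fin 4 → ℝ :=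
  ![fraction M.base c.tape.left, ((c.tape.head : ℕ) : ℝ),
    fraction M.base c.tape.right, ((c.state : ℕ) : ℝ)]

/-- The point `v` fully and unambiguously describes the configuration `c` among those of space at
most `S`: `c` is one of them, `v` is at distance at most `k ^ (-S) / 4` from `[c]` for the maximum
norm, and this holds for no other configuration of space at most `S`. -/
def Describes (S : ℕ) (v : Fin 4 → ℝ) (c : M.Config) : Prop :=
  M.space c ≤ S ∧ ‖v - M.encode c‖ ≤ 1 / (4 * (M.base : ℝ) ^ S) ∧
    ∀ c' : M.Config, M.space c' ≤ S → ‖v - M.encode c'‖ ≤ 1 / (4 * (M.base : ℝ) ^ S) → c' = c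

end Machine

/-- `y` solves `y' = p(y)`, `y(0) = y₀` on the interval `[0, T]`. -/
def IsSolution {ι : Type} [Fintype ι] (p : ι → MvPolynomial ι ℝ) (y₀ : ι → ℝ) (T : ℝ)
    (y : ℝ → ι → ℝ) : Prop :=
  y 0 = y₀ ∧ ∀ t ∈ Set.Icc 0 T,
    HasDerivWithinAt y (fun i => MvPolynomial.eval (y t) (p i)) (Set.Icc 0 T) t

/-- `ψ : ℝ² → ℝᵐ` is a simple encoding of two parameters: each coordinate of `ψ(S, T)` is
`a(S, T) * exp (b(S, T))` for two polynomials `a` and `b`. -/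
def IsSimple {m : ℕ} (ψ : ℝ → ℝ → Fin m → ℝ) : Prop :=
  ∀ i, ∃ a b : MvPolynomial (Fin 2) ℝ, ∀ S T : ℝ,
    ψ S T i = MvPolynomial.eval ![S, T] a * Real.exp (MvPolynomial.eval ![S, T] b)

end GPACSim

namespace GPACSim

open Set Turing

/-! ### Half tapes as fractions -/

/-! The flow imitates a clocked sample-and-hold circuit, one machine step per unit of time. Two
pulses in antiphase drive two groups of unknowns. During the first half of a unit of time, `u`
relaxes to affine readouts of `z`, which stores the encoded configuration and is almost frozen.
During the second half `u` is almost frozen and `z` relaxes to the encoding of the next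
configuration, computed from `u`.

That encoding is a polynomial in the readouts and their signs (`Machine.eval_update`). The base
exceeds the number of symbols, so fractions with different first digits are separated by a gap.
Signs of threshold functions placed in the gaps reveal the digit, and all readouts stay away from
`0` by a fixed margin. A sigmoid of steepness `A` therefore replaces each sign with exponentially
small error.

The pulses also have strength `A`: total mass at least `A / 8` when active, mass at most `A ^ 2 *
exp (-A)` when idle. One unit of time turns an error `E` into at most `K * (E + η)`, where `η = A ^
2 * exp (-(κ * A))` and `K` does not depend on `A` (`abs_sub_le_of_two_phases`, `loop_bounds`,
`exists_loop`). After `n` steps the error is at most a constant to the power `n` times `η`, so an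
`A` linear in `S + T` brings it below the separation of encodings (`exists_steepness`).

Pulses, sine, cosine and sigmoids all satisfy polynomial equations once `A` is carried as a constant
unknown (`isSolution_systemCurve`). No unknown exceeds a quadratic polynomial in `A`. -/

theorem fraction_eq {r : ℕ} (k : ℕ) (L : ListBlank (Fin (r + 1))) :
    fraction k L = (((L.head : ℕ) : ℝ) + fraction k L.tail) / k := by
  have hsum : Summable fun i : ℕ => ((L.nth i : ℕ) : ℝ) / (k : ℝ) ^ (i + 1) := by
    obtain ⟨n, hn⟩ := halfLength_set_nonempty L
    refine summable_of_ne_finset_zero (s := Finset.range n) fun i hi => ?_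
    rw [hn i (by simpa using hi)]
    simp
  unfold fraction
  rw [hsum.tsum_eq_zero_add, add_div, ← tsum_div_const]
  congr 1
  · simp
  · refine tsum_congr fun i => ?_
    rw [ListBlank.nth_succ, pow_succ, div_div]

theorem fraction_eq_zero {r : ℕ} (k : ℕ) (L : ListBlank (Fin (r + 1)))
    (h : ∀ i, L.nth i = default) : fraction k L = 0 := by
  simp [fraction, h]

theorem fraction_cons {r : ℕ} (k : ℕ) (a : Fin (r + 1)) (L : ListBlank (Fin (r + 1))) :
    fraction k (L.cons a) = (((a : ℕ) : ℝ) + fraction k L) / k := by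
  rw [fraction_eq, ListBlank.head_cons, ListBlank.tail_cons]

/-- The upper bound is the fixed point of `x ↦ (r + x) / (r + 2)`, that is `0.rrr…` in base `r + 2`.
It is below `1` because the digit `r + 1` never occurs; this leaves the gap used to read digits. -/
theorem fraction_mem_Icc {r : ℕ} (L : ListBlank (Fin (r + 1))) :
    fraction (r + 2) L ∈ Icc (0 : ℝ) (r / (r + 1)) := by
  induction L using ListBlank.induction_on with
  | h l =>
    induction l with
    | nil =>
      rw [fraction_eq_zero _ _ fun i => by rw [ListBlank.nth_mk]; exact List.getI_nil ..]
      exact ⟨le_rfl, by positivity⟩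
    | cons a l ih =>
      rw [← ListBlank.cons_mk, fraction_cons]
      have ha : ((a : ℕ) : ℝ) ≤ r := by exact_mod_cast Nat.lt_succ_iff.1 a.2
      refine ⟨div_nonneg (add_nonneg (by positivity) ih.1) (by positivity), ?_⟩
      rw [div_le_iff₀ (by positivity)]
      calc ((a : ℕ) : ℝ) + fraction (r + 2) (ListBlank.mk l) ≤ r + r / (r + 1) :=
            add_le_add ha ih.2
        _ = _ := by push_cast; field_simp; ring

theorem fraction_tail {r : ℕ} (L : ListBlank (Fin (r + 1))) :
    fraction (r + 2) L.tail = (r + 2) * fraction (r + 2) L - ((L.head : ℕ) : ℝ) := by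
  rw [fraction_eq _ L]
  push_cast
  field_simp
  ring

theorem nth_eq_default_of_halfLength_le {r : ℕ} (L : ListBlank (Fin (r + 1))) {n i : ℕ}
    (h : halfLength L ≤ n) (hi : n ≤ i) : L.nth i = default :=
  Nat.sInf_mem (halfLength_set_nonempty L) i (h.trans hi)

theorem fin_eq_of_abs_sub_lt_one {n : ℕ} {a b : Fin n}
    (h : |((a : ℕ) : ℝ) - ((b : ℕ) : ℝ)| < 1) : a = b := by
  apply Fin.ext
  have : |((a : ℕ) : ℤ) - ((b : ℕ) : ℤ)| < 1 := by exact_mod_cast h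
  have := Int.abs_lt_one_iff.1 this
  omega

/-- Half tapes of length at most `n` are separated by their fractions. -/
theorem eq_of_abs_fraction_sub_lt {r : ℕ} (n : ℕ) (L L' : ListBlank (Fin (r + 1)))
    (hL : ∀ i, n ≤ i → L.nth i = default) (hL' : ∀ i, n ≤ i → L'.nth i = default)
    (h : |fraction (r + 2) L - fraction (r + 2) L'| < 1 / ((r : ℝ) + 2) ^ n) : L = L' := by
  induction n generalizing L L' with
  | zero => exact ListBlank.ext fun i => by rw [hL i (Nat.zero_le _), hL' i (Nat.zero_le _)]
  | succ n ih =>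
    have hk : (0 : ℝ) < (r : ℝ) + 2 := by positivity
    have h1 : |(r + 2) * fraction (r + 2) L - (r + 2) * fraction (r + 2) L'|
        < 1 / ((r : ℝ) + 2) ^ n := by
      rw [← mul_sub, abs_mul, abs_of_pos hk]
      calc _ < ((r : ℝ) + 2) * (1 / ((r : ℝ) + 2) ^ (n + 1)) := by gcongr
        _ = _ := by rw [pow_succ]; field_simp
    have ht := fraction_tail L
    have ht' := fraction_tail L'
    have hb := fraction_mem_Icc L.tail
    have hb' := fraction_mem_Icc L'.tail
    have htail : ∀ i, n ≤ i → L.tail.nth i = default := fun i hi => by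
      rw [← ListBlank.nth_succ]; exact hL _ (by omega)
    have htail' : ∀ i, n ≤ i → L'.tail.nth i = default := fun i hi => by
      rw [← ListBlank.nth_succ]; exact hL' _ (by omega)
    have hdiff : |(((L.head : ℕ) : ℝ) - ((L'.head : ℕ) : ℝ))| < 1 := by
      -- The tails contribute at most `1 - 1 / (r + 1)`. For `n > 0` the remaining difference is at
      -- most `1 / (r + 2) < 1 / (r + 1)`, so the heads differ by less than `1`. For `n = 0` it is
      -- only known to be below `1`, but then the tails vanish.
      rcases Nat.eq_zero_or_pos n with rfl | hn
      · have e := fraction_eq_zero (r + 2) L.tail fun i => htail i (Nat.zero_le _)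
        have e' := fraction_eq_zero (r + 2) L'.tail fun i => htail' i (Nat.zero_le _)
        rw [show (((L.head : ℕ) : ℝ) - ((L'.head : ℕ) : ℝ)) =
          (r + 2) * fraction (r + 2) L - (r + 2) * fraction (r + 2) L' by linarith]
        simpa using h1
      · have h2 : 1 / ((r : ℝ) + 2) ^ n ≤ 1 / (r + 2) := by
          apply one_div_le_one_div_of_le hk
          calc ((r : ℝ) + 2) = ((r : ℝ) + 2) ^ 1 := (pow_one _).symm
            _ ≤ _ := pow_le_pow_right₀ (by linarith) hn
        have h3 : 1 / ((r : ℝ) + 2) < 1 / (r + 1) :=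
          one_div_lt_one_div_of_lt (by positivity) (by linarith)
        have h4 : (r : ℝ) / (r + 1) = 1 - 1 / (r + 1) := by field_simp; ring
        rw [h4] at hb hb'
        rw [abs_lt] at h1 ⊢
        constructor <;> linarith [hb.1, hb.2, hb'.1, hb'.2, h1.1, h1.2]
    have hhead : L.head = L'.head := fin_eq_of_abs_sub_lt_one hdiff
    have htails : L.tail = L'.tail := by
      apply ih _ _ htail htail'
      rw [ht, ht', hhead]
      simpa using h1
    rw [← ListBlank.cons_head_tail L, ← ListBlank.cons_head_tail L', hhead, htails]

/-! ### Separation of encoded configurations -/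

namespace Machine

variable (M : Machine)

theorem config_eq_of_norm_sub_lt {S : ℕ} {c c' : M.Config} (hc : M.space c ≤ S)
    (hc' : M.space c' ≤ S) (h : ‖M.encode c - M.encode c'‖ < 1 / (M.base : ℝ) ^ S) : c = c' := by
  have hpos : (0 : ℝ) < 1 / (M.base : ℝ) ^ S := by
    have : (0 : ℝ) < M.base := by unfold base; positivity
    positivity
  have hle1 : 1 / (M.base : ℝ) ^ S ≤ 1 := by
    rw [div_le_one (by have : (0 : ℝ) < M.base := by (unfold base; positivity)
                       positivity)]
    exact one_le_pow₀ (by unfold base; push_cast; linarith [(M.nonblank).cast_nonneg (α := ℝ)])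
  rw [pi_norm_lt_iff hpos] at h
  have h0 := h 0
  have h1 := h 1
  have h2 := h 2
  have h3 := h 3
  simp only [encode, Pi.sub_apply, Matrix.cons_val, Real.norm_eq_abs] at h0 h1 h2 h3
  have hb : (M.base : ℝ) = (M.nonblank : ℝ) + 2 := by simp [base]
  unfold space at hc hc'
  rw [hb] at h0 h2
  have e0 := eq_of_abs_fraction_sub_lt S _ _
    (fun i hi => nth_eq_default_of_halfLength_le c.tape.left (by omega) hi)
    (fun i hi => nth_eq_default_of_halfLength_le c'.tape.left (by omega) hi) h0
  have e2 := eq_of_abs_fraction_sub_lt S _ _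
    (fun i hi => nth_eq_default_of_halfLength_le c.tape.right (by omega) hi)
    (fun i hi => nth_eq_default_of_halfLength_le c'.tape.right (by omega) hi) h2
  have e1 := fin_eq_of_abs_sub_lt_one (h1.trans_le hle1)
  have e3 := fin_eq_of_abs_sub_lt_one (h3.trans_le hle1)
  obtain ⟨q, t⟩ := c
  obtain ⟨q', t'⟩ := c'
  obtain ⟨a, l, b⟩ := t
  obtain ⟨a', l', b'⟩ := t'
  simp only at e0 e1 e2 e3
  subst e0 e1 e2 e3
  rfl

theorem describes_of_norm_sub_le {S : ℕ} {v : Fin 4 → ℝ} {c : M.Config} (hc : M.space c ≤ S)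
    (h : ‖v - M.encode c‖ ≤ 1 / (4 * (M.base : ℝ) ^ S)) : M.Describes S v c := by
  refine ⟨hc, h, fun c' hc' h' => (M.config_eq_of_norm_sub_lt hc hc' ?_).symm⟩
  have hpos : (0 : ℝ) < (M.base : ℝ) ^ S := by
    have : (0 : ℝ) < M.base := by unfold base; positivity
    positivity
  calc ‖M.encode c - M.encode c'‖ = ‖(v - M.encode c') - (v - M.encode c)‖ := by congr 1; abel
    _ ≤ _ := norm_sub_le _ _
    _ ≤ 1 / (4 * (M.base : ℝ) ^ S) + 1 / (4 * (M.base : ℝ) ^ S) := add_le_add h' h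
    _ < _ := by
      rw [← add_div, div_lt_div_iff₀ (by positivity) hpos]
      linarith

end Machine

/-! ### Ordinary differential equations -/

section ODE

open Real

/-- Integrating factor: `(x - ℓ - δ) * exp (∫ φ)` has derivative `φ * exp (∫ φ) * (g - ℓ - δ) ≤ 0`.
The two-sided bound follows by applying this to `x` and `-x`. -/
theorem relaxation_sub_le {φ g x : ℝ → ℝ} {a b ℓ δ : ℝ} (hab : a ≤ b) (hφc : Continuous φ)
    (hφ : ∀ t, 0 ≤ φ t)
    (hx : ∀ t ∈ Icc a b, HasDerivWithinAt x (φ t * (g t - x t)) (Icc a b) t)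
    (hg : ∀ t ∈ Icc a b, g t - ℓ ≤ δ) :
    x b - ℓ ≤ δ * (1 - exp (-∫ s in a..b, φ s)) + (x a - ℓ) * exp (-∫ s in a..b, φ s) := by
  have hΦ : ∀ t, HasDerivAt (fun t => ∫ s in a..t, φ s) (φ t) t := fun t =>
    intervalIntegral.integral_hasDerivAt_right (hφc.intervalIntegrable _ _)
      (hφc.stronglyMeasurableAtFilter _ _) hφc.continuousAt
  have hX : ∀ t ∈ Icc a b, HasDerivWithinAt
      (fun t => (x t - ℓ - δ) * exp (∫ s in a..t, φ s))
      (φ t * (g t - x t) * exp (∫ s in a..t, φ s) +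
        (x t - ℓ - δ) * (exp (∫ s in a..t, φ s) * φ t)) (Icc a b) t := fun t ht =>
    (((hx t ht).sub_const ℓ).sub_const δ).mul (hΦ t).exp.hasDerivWithinAt
  have hanti : AntitoneOn (fun t => (x t - ℓ - δ) * exp (∫ s in a..t, φ s)) (Icc a b) := by
    refine antitoneOn_of_hasDerivWithinAt_nonpos (convex_Icc a b)
      (fun t ht => (hX t ht).continuousWithinAt)
      (fun t ht => (hX t (interior_subset ht)).mono interior_subset) fun t ht => ?_
    have h1 := hg t (interior_subset ht)
    have h2 : 0 ≤ φ t * exp (∫ s in a..t, φ s) := mul_nonneg (hφ t) (exp_pos _).le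
    nlinarith
  have h := hanti (left_mem_Icc.2 hab) (right_mem_Icc.2 hab) hab
  simp only [intervalIntegral.integral_same, exp_zero, mul_one] at h
  have h2 := mul_le_mul_of_nonneg_right h (exp_pos (-∫ s in a..b, φ s)).le
  rw [mul_assoc, ← exp_add, add_neg_cancel, exp_zero] at h2
  linarith

/-- A quantity that relaxes towards a target which stays within `δ` of `ℓ`. -/
theorem abs_relaxation_sub_le {φ g x : ℝ → ℝ} {a b ℓ δ : ℝ} (hab : a ≤ b) (hφc : Continuous φ)
    (hφ : ∀ t, 0 ≤ φ t)
    (hx : ∀ t ∈ Icc a b, HasDerivWithinAt x (φ t * (g t - x t)) (Icc a b) t)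
    (hg : ∀ t ∈ Icc a b, |g t - ℓ| ≤ δ) :
    |x b - ℓ| ≤
      δ * (1 - exp (-∫ s in a..b, φ s)) + |x a - ℓ| * exp (-∫ s in a..b, φ s) := by
  have h1 := relaxation_sub_le hab hφc hφ hx fun t ht => (abs_le.1 (hg t ht)).2
  have h2 := relaxation_sub_le (x := fun t => -x t) (g := fun t => -g t) (ℓ := -ℓ) (δ := δ)
    hab hφc hφ (fun t ht => (hx t ht).neg.congr_deriv (by ring))
    fun t ht => by linarith [(abs_le.1 (hg t ht)).1]
  have he := (exp_pos (-∫ s in a..b, φ s)).le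
  have h3 := mul_le_mul_of_nonneg_right (le_abs_self (x a - ℓ)) he
  have h4 := mul_le_mul_of_nonneg_right (neg_abs_le (x a - ℓ)) he
  rw [abs_le]
  constructor <;> linarith

/-! ### Global existence and uniqueness -/

theorem lipschitzWith_clamp {ι : Type*} [Fintype ι] (R : ℝ) :
    LipschitzWith 1 fun (x : ι → ℝ) i => max (-R) (min R (x i)) := by
  refine LipschitzWith.of_dist_le_mul fun x y => ?_
  rw [NNReal.coe_one, one_mul, dist_pi_le_iff dist_nonneg]
  intro i
  refine le_trans ?_ (dist_le_pi_dist x y i)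
  rw [Real.dist_eq, Real.dist_eq]
  refine (abs_max_sub_max_le_max _ _ _ _).trans ?_
  rw [sub_self, abs_zero, max_eq_right (abs_nonneg _)]
  refine (abs_min_sub_min_le_max _ _ _ _).trans ?_
  rw [sub_self, abs_zero, max_eq_right (abs_nonneg _)]

theorem abs_clamp_le {R : ℝ} (hR : 0 ≤ R) (x : ℝ) : |max (-R) (min R x)| ≤ R :=
  abs_le.2 ⟨le_max_left _ _, max_le (by linarith) (min_le_left _ _)⟩

theorem clamp_eq_self {R x : ℝ} (h : |x| ≤ R) : max (-R) (min R x) = x := by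
  rw [min_eq_right (abs_le.1 h).2, max_eq_right (abs_le.1 h).1]

/-- Global existence for globally Lipschitz vector fields. -/
theorem exists_hasDerivWithinAt_of_lipschitzWith {ι : Type*} [Fintype ι]
    {F : ℝ → (ι → ℝ) → ι → ℝ} {K : NNReal} {T : ℝ} (hT : 0 ≤ T)
    (hL : ∀ t ∈ Icc 0 T, LipschitzWith K (F t))
    (hc : ∀ x, ContinuousOn (fun t => F t x) (Icc 0 T)) (x₀ : ι → ℝ) :
    ∃ y : ℝ → ι → ℝ, y 0 = x₀ ∧
      ∀ t ∈ Icc 0 T, HasDerivWithinAt y (F t (y t)) (Icc 0 T) t := by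
  obtain ⟨M, hM⟩ := isCompact_Icc.exists_bound_of_continuousOn (hc 0)
  have hM0 : 0 ≤ M := (norm_nonneg _).trans (hM 0 (left_mem_Icc.2 hT))
  -- Gronwall's a priori bound. Clamping the argument at `R` makes the field bounded, so
  -- Picard–Lindelöf covers all of `[0, T]` at once; the solution obeys the same Gronwall bound,
  -- hence never meets the clamp.
  set R := gronwallBound ‖x₀‖ K M T with hR
  have hmono := gronwallBound_mono (norm_nonneg x₀) hM0 K.2
  have hR0 : ‖x₀‖ ≤ R := by
    have := hmono hT
    rwa [gronwallBound_x0] at this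
  have hR' : 0 ≤ R := (norm_nonneg _).trans hR0
  set cl : (ι → ℝ) → ι → ℝ := fun x i => max (-R) (min R (x i)) with hcl
  have hclL : LipschitzWith 1 cl := lipschitzWith_clamp R
  have hcl0 : cl 0 = 0 := by
    funext i
    exact clamp_eq_self (by simpa using hR')
  have hcl_le : ∀ x, ‖cl x‖ ≤ ‖x‖ := fun x => by
    have := hclL.dist_le_mul x 0
    rwa [hcl0, dist_zero_right, dist_zero_right, NNReal.coe_one, one_mul] at this
  have hclR : ∀ x, ‖cl x‖ ≤ R := fun x =>
    (pi_norm_le_iff_of_nonneg hR').2 fun i => abs_clamp_le hR' (x i)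
  have hF : ∀ t ∈ Icc 0 T, ∀ x, ‖F t x‖ ≤ K * ‖x‖ + M := fun t ht x => by
    have h1 := (hL t ht).dist_le_mul x 0
    rw [dist_zero_right, dist_eq_norm] at h1
    have h2 := norm_le_norm_add_norm_sub' (F t x) (F t 0)
    linarith [hM t ht]
  have hLL : 0 ≤ (K : ℝ) * R + M := by positivity
  have hPL : IsPicardLindelof (fun t x => F t (cl x)) (tmin := 0) (tmax := T)
      ⟨0, left_mem_Icc.2 hT⟩ x₀ (Real.toNNReal ((K * R + M) * T)) 0
      (Real.toNNReal (K * R + M)) K := by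
    constructor
    · intro t ht
      have := (hL t ht).comp hclL
      rw [mul_one] at this
      exact this.lipschitzOnWith
    · intro x _
      exact hc _
    · intro t ht x _
      rw [Real.coe_toNNReal _ hLL]
      refine (hF t ht _).trans ?_
      gcongr
      exact hclR x
    · rw [Real.coe_toNNReal _ hLL, Real.coe_toNNReal _ (mul_nonneg hLL hT)]
      simp [hT]
  obtain ⟨y, hy0, hy⟩ := hPL.exists_eq_forall_mem_Icc_hasDerivWithinAt₀
  refine ⟨y, hy0, fun t ht => ?_⟩
  have hbound := norm_le_gronwallBound_of_norm_deriv_right_le (f := y)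
    (f' := fun t => F t (cl (y t))) (δ := ‖x₀‖) (K := K) (ε := M) (a := 0) (b := T)
    (fun s hs => (hy s hs).continuousWithinAt)
    (fun s hs => (hy s (Ico_subset_Icc_self hs)).mono_of_mem_nhdsWithin
      (Icc_mem_nhdsGE_of_mem hs))
    (by rw [hy0])
    (fun s hs => (hF s (Ico_subset_Icc_self hs) _).trans (by gcongr; exact hcl_le _)) t ht
  rw [sub_zero] at hbound
  have hyR : ‖y t‖ ≤ R := hbound.trans (hmono ht.2)
  have hcly : cl (y t) = y t := by
    funext i
    exact clamp_eq_self ((norm_le_pi_norm (y t) i).trans hyR)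
  have := hy t ht
  rwa [hcly] at this

theorem exists_lipschitzOnWith_closedBall {ι κ : Type*} [Fintype ι] [Fintype κ]
    {f : (ι → ℝ) → κ → ℝ} (hf : ContDiff ℝ 1 f) (R : ℝ) :
    ∃ K, LipschitzOnWith K f (Metric.closedBall 0 R) :=
  LocallyLipschitzOn.exists_lipschitzOnWith_of_compact (isCompact_closedBall _ _)
    hf.locallyLipschitz.locallyLipschitzOn

theorem contDiff_eval {ι : Type*} [Fintype ι] (p : MvPolynomial ι ℝ) :
    ContDiff ℝ 1 fun x : ι → ℝ => MvPolynomial.eval x p := by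
  induction p using MvPolynomial.induction_on with
  | C a => simpa using contDiff_const
  | add p q hp hq => simpa using hp.add hq
  | mul_X p i hp => simpa using hp.mul (contDiff_apply ℝ ℝ i)

theorem contDiff_eval_pi {ι κ : Type*} [Fintype ι] [Fintype κ] (p : κ → MvPolynomial ι ℝ) :
    ContDiff ℝ 1 fun (x : ι → ℝ) i => MvPolynomial.eval x (p i) :=
  contDiff_pi.2 fun i => contDiff_eval (p i)

/-- Both solutions are continuous on a compact interval, so they stay in a common ball, where the
polynomial field is Lipschitz. -/
theorem IsSolution.eqOn {ι : Type} [Fintype ι] {p : ι → MvPolynomial ι ℝ} {y₀ : ι → ℝ} {T : ℝ}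
    {y z : ℝ → ι → ℝ} (hz : IsSolution p y₀ T z) (hy : IsSolution p y₀ T y) :
    EqOn z y (Icc 0 T) := by
  have hyc : ContinuousOn y (Icc 0 T) := fun t ht => (hy.2 t ht).continuousWithinAt
  have hzc : ContinuousOn z (Icc 0 T) := fun t ht => (hz.2 t ht).continuousWithinAt
  obtain ⟨R₁, h₁⟩ := isCompact_Icc.exists_bound_of_continuousOn hyc
  obtain ⟨R₂, h₂⟩ := isCompact_Icc.exists_bound_of_continuousOn hzc
  obtain ⟨K, hK⟩ := exists_lipschitzOnWith_closedBall (contDiff_eval_pi p) (max R₁ R₂)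
  refine ODE_solution_unique_of_mem_Icc_right
    (v := fun _ x i => MvPolynomial.eval x (p i)) (s := fun _ => Metric.closedBall 0 (max R₁ R₂))
    (K := K) (fun _ _ => hK) hzc (fun t ht => ?_) (fun t ht => ?_) hyc (fun t ht => ?_)
    (fun t ht => ?_) (hz.1.trans hy.1.symm)
  · exact (hz.2 t (Ico_subset_Icc_self ht)).mono_of_mem_nhdsWithin (Icc_mem_nhdsGE_of_mem ht)
  · rw [mem_closedBall_zero_iff]
    exact (h₂ t (Ico_subset_Icc_self ht)).trans (le_max_right _ _)
  · exact (hy.2 t (Ico_subset_Icc_self ht)).mono_of_mem_nhdsWithin (Icc_mem_nhdsGE_of_mem ht)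
  · rw [mem_closedBall_zero_iff]
    exact (h₁ t (Ico_subset_Icc_self ht)).trans (le_max_left _ _)

theorem IsSolution.reindex {ι ι' : Type} [Fintype ι] [Fintype ι'] (e : ι ≃ ι')
    {p : ι → MvPolynomial ι ℝ} {y₀ : ι → ℝ} {T : ℝ} {y : ℝ → ι → ℝ} (hy : IsSolution p y₀ T y) :
    IsSolution (fun i => MvPolynomial.rename e (p (e.symm i))) (y₀ ∘ e.symm) T
      (fun t => y t ∘ e.symm) := by
  refine ⟨by simp only [hy.1], fun t ht => hasDerivWithinAt_pi.2 fun i => ?_⟩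
  have h := hasDerivWithinAt_pi.1 (hy.2 t ht) (e.symm i)
  rw [MvPolynomial.eval_rename, Function.comp_assoc, e.symm_comp_self, Function.comp_id]
  exact h

/-! ### Periodic pulses -/

/-- A function of period `1` that is large around `1 / 4` and tiny between `1 / 2` and `1`. -/
noncomputable def pulse (A t : ℝ) : ℝ := A ^ 2 * exp (A * (sin (2 * π * t) - 1))

theorem continuous_pulse (A : ℝ) : Continuous (pulse A) := by
  unfold pulse
  fun_prop

theorem pulse_nonneg (A t : ℝ) : 0 ≤ pulse A t := by
  unfold pulse
  positivity

theorem pulse_le {A : ℝ} (hA : 0 ≤ A) (t : ℝ) : pulse A t ≤ A ^ 2 := by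
  unfold pulse
  apply mul_le_of_le_one_right (by positivity)
  rw [exp_le_one_iff]
  exact mul_nonpos_of_nonneg_of_nonpos hA (by linarith [sin_le_one (2 * π * t)])

theorem pulse_zero (A : ℝ) : pulse A 0 = A ^ 2 * exp (-A) := by
  simp [pulse]

theorem pulse_half (A : ℝ) : pulse A (0 + 1 / 2) = A ^ 2 * exp (-A) := by
  simp [pulse, show 2 * π * 2⁻¹ = π by ring]

theorem pulse_add_nat (A t : ℝ) (n : ℕ) : pulse A (t + n) = pulse A t := by
  rw [pulse, show 2 * π * (t + n) = 2 * π * t + n * (2 * π) by ring, sin_add_nat_mul_two_pi, pulse]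

theorem hasDerivAt_pulse (A t : ℝ) :
    HasDerivAt (pulse A) (A * (2 * π) * cos (2 * π * t) * pulse A t) t := by
  have h1 : HasDerivAt (fun t : ℝ => 2 * π * t) (2 * π) t := by
    simpa using (hasDerivAt_id t).const_mul (2 * π)
  have h := (((h1.sin.sub_const 1).const_mul A).exp).const_mul (A ^ 2)
  refine h.congr_deriv ?_
  unfold pulse
  ring

theorem pulse_le_of_mem_Icc {A : ℝ} (hA : 0 ≤ A) {t : ℝ} (ht : t ∈ Icc (1 / 2 : ℝ) 1) :
    pulse A t ≤ A ^ 2 * exp (-A) := by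
  unfold pulse
  gcongr
  have h : sin (2 * π * t) ≤ 0 := by
    rw [← sin_sub_two_pi]
    apply sin_nonpos_of_nonpos_of_neg_pi_le <;> nlinarith [pi_pos, ht.1, ht.2]
  nlinarith

/-- In this window the phase `x` measured from the peak is at most `1 / A`, since `2 * π ≤ 8`. Hence
`A * (1 - cos x) ≤ A * x ^ 2 / 2 ≤ 1 / 2`, and `exp (-1 / 2) ≥ 1 / 2`. -/
theorem half_sq_le_pulse {A : ℝ} (hA : 1 ≤ A) {t : ℝ} (ht : |t - 1 / 4| ≤ 1 / (8 * A)) :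
    A ^ 2 / 2 ≤ pulse A t := by
  have hA0 : 0 < A := by linarith
  have h1 : sin (2 * π * t) = cos (2 * π * (t - 1 / 4)) := by
    rw [← sin_add_pi_div_two]
    congr 1
    ring
  have h2 := one_sub_sq_div_two_le_cos (x := 2 * π * (t - 1 / 4))
  have h3 : (2 * π * (t - 1 / 4)) ^ 2 ≤ 1 / A ^ 2 := by
    rw [← sq_abs, abs_mul, abs_of_pos (by positivity : 0 < 2 * π), ← one_div_pow]
    have h4 : 2 * π * |t - 1 / 4| ≤ 1 / A := by
      calc 2 * π * |t - 1 / 4| ≤ 2 * 4 * (1 / (8 * A)) := by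
            gcongr
            exact pi_le_four
        _ = 1 / A := by field_simp; norm_num
    gcongr
  have h5 : -(1 / 2) ≤ A * (sin (2 * π * t) - 1) := by
    rw [h1]
    have h6 : A * (1 / A ^ 2) ≤ 1 := by
      rw [show A * (1 / A ^ 2) = 1 / A by field_simp]
      rw [div_le_one hA0]
      exact hA
    nlinarith
  unfold pulse
  have h7 := add_one_le_exp (A * (sin (2 * π * t) - 1))
  have h8 : 1 / 2 ≤ exp (A * (sin (2 * π * t) - 1)) := by linarith
  nlinarith [sq_nonneg A]

/-- The window has width `1 / (4 * A)` and height at least `A ^ 2 / 2`. The prefactor `A ^ 2` of the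
pulse thus makes its mass grow linearly, while its height stays polynomial. -/
theorem le_integral_pulse {A : ℝ} (hA : 1 ≤ A) (n : ℕ) :
    A / 8 ≤ ∫ t in (n : ℝ)..(n + 1 / 2), pulse A t := by
  have hA0 : 0 < A := by linarith
  have hs : 1 / (8 * A) ≤ 1 / 8 := by
    apply one_div_le_one_div_of_le <;> linarith
  have hs0 : 0 < 1 / (8 * A) := by positivity
  have h1 : ∫ t in (n : ℝ)..(n + 1 / 2), pulse A t = ∫ t in (0 : ℝ)..(1 / 2), pulse A t := by
    have := intervalIntegral.integral_comp_add_right (a := 0) (b := 1 / 2) (pulse A) (n : ℝ)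
    simp only [pulse_add_nat] at this
    rw [this]
    congr 1 <;> ring
  rw [h1]
  calc A / 8 = ∫ _t in (1 / 4 - 1 / (8 * A))..(1 / 4 + 1 / (8 * A)), A ^ 2 / 2 := by
        rw [intervalIntegral.integral_const, smul_eq_mul]
        field_simp
        ring
    _ ≤ ∫ t in (1 / 4 - 1 / (8 * A))..(1 / 4 + 1 / (8 * A)), pulse A t := by
        refine intervalIntegral.integral_mono_on (by linarith) (by simp)
          ((continuous_pulse A).intervalIntegrable _ _) fun t ht => half_sq_le_pulse hA ?_
        rw [abs_le]
        constructor <;> linarith [ht.1, ht.2]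
    _ ≤ _ := by
        refine intervalIntegral.integral_mono_interval (by linarith) (by linarith) (by linarith)
          (Filter.Eventually.of_forall fun t => pulse_nonneg A t)
          ((continuous_pulse A).intervalIntegrable _ _)

theorem integral_pulse_le {A : ℝ} (hA : 0 ≤ A) (n : ℕ) {a b : ℝ} (hab : a ≤ b)
    (ha : (n : ℝ) + 1 / 2 ≤ a) (hb : b ≤ n + 1) :
    ∫ t in a..b, pulse A t ≤ A ^ 2 * exp (-A) := by
  calc ∫ t in a..b, pulse A t ≤ ∫ _t in a..b, A ^ 2 * exp (-A) := by
        refine intervalIntegral.integral_mono_on hab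
          ((continuous_pulse A).intervalIntegrable _ _) (by simp) fun t ht => ?_
        rw [show t = (t - n) + n by ring, pulse_add_nat]
        exact pulse_le_of_mem_Icc hA ⟨by linarith [ht.1], by linarith [ht.2]⟩
    _ = (b - a) * (A ^ 2 * exp (-A)) := by rw [intervalIntegral.integral_const, smul_eq_mul]
    _ ≤ _ := by
        apply mul_le_of_le_one_left (by positivity)
        linarith


/-! ### Relaxation under a bounded, a weak and a strong drive -/

section Relaxation

variable {φ g x : ℝ → ℝ} {a b ℓ δ : ℝ}

theorem abs_relaxation_sub_le_of_le (hφc : Continuous φ) (hφ : ∀ t, 0 ≤ φ t)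
    (hx : ∀ t ∈ Icc a b, HasDerivWithinAt x (φ t * (g t - x t)) (Icc a b) t)
    (hg : ∀ t ∈ Icc a b, |g t - ℓ| ≤ δ) (h : |x a - ℓ| ≤ δ) {t : ℝ} (ht : t ∈ Icc a b) :
    |x t - ℓ| ≤ δ := by
  have hsub : Icc a t ⊆ Icc a b := Icc_subset_Icc_right ht.2
  have h1 := abs_relaxation_sub_le ht.1 hφc hφ (fun s hs => (hx s (hsub hs)).mono hsub)
    fun s hs => hg s (hsub hs)
  have h2 := mul_le_mul_of_nonneg_right h (exp_pos (-∫ s in a..t, φ s)).le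
  linarith

theorem abs_relaxation_sub_le_drift (hab : a ≤ b) (hφc : Continuous φ) (hφ : ∀ t, 0 ≤ φ t)
    (hx : ∀ t ∈ Icc a b, HasDerivWithinAt x (φ t * (g t - x t)) (Icc a b) t)
    (hg : ∀ t ∈ Icc a b, |g t - ℓ| ≤ δ) {t ε : ℝ} (ht : t ∈ Icc a b)
    (hε : ∫ s in a..t, φ s ≤ ε) :
    |x t - ℓ| ≤ δ * ε + |x a - ℓ| := by
  have hsub : Icc a t ⊆ Icc a b := Icc_subset_Icc_right ht.2
  have hδ : 0 ≤ δ := (abs_nonneg _).trans (hg a (left_mem_Icc.2 hab))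
  have h1 := abs_relaxation_sub_le ht.1 hφc hφ (fun s hs => (hx s (hsub hs)).mono hsub)
    fun s hs => hg s (hsub hs)
  have hI : 0 ≤ ∫ s in a..t, φ s := intervalIntegral.integral_nonneg ht.1 fun s _ => hφ s
  have h2 : exp (-∫ s in a..t, φ s) ≤ 1 := exp_le_one_iff.2 (by linarith)
  have h3 : 1 - exp (-∫ s in a..t, φ s) ≤ ε := by
    linarith [add_one_le_exp (-∫ s in a..t, φ s)]
  have h4 := mul_le_mul_of_nonneg_left h3 hδ
  have h5 := mul_le_mul_of_nonneg_left h2 (abs_nonneg (x a - ℓ))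
  linarith

theorem abs_relaxation_sub_le_contract (hab : a ≤ b) (hφc : Continuous φ) (hφ : ∀ t, 0 ≤ φ t)
    (hx : ∀ t ∈ Icc a b, HasDerivWithinAt x (φ t * (g t - x t)) (Icc a b) t)
    (hg : ∀ t ∈ Icc a b, |g t - ℓ| ≤ δ) {η : ℝ} (hη : exp (-∫ s in a..b, φ s) ≤ η) :
    |x b - ℓ| ≤ δ + |x a - ℓ| * η := by
  have hδ : 0 ≤ δ := (abs_nonneg _).trans (hg a (left_mem_Icc.2 hab))
  have h1 := abs_relaxation_sub_le hab hφc hφ hx hg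
  have h4 := mul_nonneg hδ (exp_pos (-∫ s in a..b, φ s)).le
  have h5 := mul_le_mul_of_nonneg_left hη (abs_nonneg (x a - ℓ))
  linarith

end Relaxation

/-- One unit of time: while `pulse A` is active, `u` is driven to an affine function of `z ≈ e`;
while it is not, `z` is driven to `g ≈ e'`. -/
theorem abs_sub_le_of_two_phases {κ J : Type*} {src : J → κ} {α β : J → ℝ} {A : ℝ} (hA : 1 ≤ A)
    (n : ℕ) {z g : ℝ → κ → ℝ} {u : ℝ → J → ℝ} {e e' : κ → ℝ} {a b B Bg Kg γ η E K : ℝ}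
    (ha : ∀ j, |α j| ≤ a) (hb : ∀ j, |β j| ≤ b) (ha0 : 0 ≤ a) (hb0 : 0 ≤ b)
    (hB : 0 ≤ B) (hBg : 0 ≤ Bg) (hKg : 0 ≤ Kg) (hγ : 0 < γ)
    (hη : A ^ 2 * exp (-A) ≤ η) (hη' : exp (-(A / 8)) ≤ η)
    (hz : ∀ i, ∀ t ∈ Icc (n : ℝ) (n + 1), HasDerivWithinAt (fun t => z t i)
      (pulse A (t + 1 / 2) * (g t i - z t i)) (Icc n (n + 1)) t)
    (hu : ∀ j, ∀ t ∈ Icc (n : ℝ) (n + 1), HasDerivWithinAt (fun t => u t j)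
      (pulse A t * (α j * z t (src j) + β j - u t j)) (Icc n (n + 1)) t)
    (he : ∀ i, |e i| ≤ B) (he' : ∀ i, |e' i| ≤ B)
    (hgB : ∀ t ∈ Icc (n : ℝ) (n + 1), ∀ i, |g t i| ≤ Bg)
    (hge : ∀ t ∈ Icc (n : ℝ) (n + 1), ∀ ρ, 0 ≤ ρ → ρ ≤ γ / 2 →
      (∀ j, |u t j - (α j * e (src j) + β j)| ≤ ρ) → ∀ i, |g t i - e' i| ≤ Kg * (ρ + η))
    (hE : ∀ i, |z n i - e i| ≤ E) (hE0 : 0 ≤ E) (hun : ∀ j, |u n j| ≤ a * (B + 1) + b)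
    (hK0 : Bg + B + 1 ≤ K)
    (hK1 : (a * (Bg + B + 1) + b) + (a * (B + 1) + b) + a * (Bg + B + 1) + 2 * (a * (B + 1) + b)
      ≤ K * (γ / 2))
    (hK2 : Kg * ((a * (Bg + B + 1) + b) + (a * (B + 1) + b) + a * (Bg + B + 1) +
      2 * (a * (B + 1) + b) + 1) + 2 * (B + 1) ≤ K)
    (hKE : K * (E + η) ≤ 1) :
    (∀ i, |z (n + 1 : ℝ) i - e' i| ≤ K * (E + η)) ∧
      ∀ t ∈ Icc (n : ℝ) (n + 1), (∀ i, |z t i| ≤ B + 1) ∧ ∀ j, |u t j| ≤ a * (B + 1) + b := by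
  have hA0 : 0 ≤ A := by linarith
  -- The first two summands bound the drift of `u` while it is held, the third the error of `z`
  -- passed on by sampling, the last what remains of the old value of `u`.
  set C₁ := (a * (Bg + B + 1) + b) + (a * (B + 1) + b) + a * (Bg + B + 1) + 2 * (a * (B + 1) + b)
    with hC₁
  have hC₁0 : 0 ≤ C₁ := by positivity
  set ε := A ^ 2 * exp (-A) with hε
  have hε0 : 0 ≤ ε := by positivity
  have hη0 : 0 ≤ η := hε0.trans hη
  have hEη : 0 ≤ E + η := by positivity
  have hφ₁ := continuous_pulse A
  have hφ₁' := pulse_nonneg A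
  have hφ₂ : Continuous fun t => pulse A (t + 1 / 2) := hφ₁.comp (by fun_prop)
  have hφ₂' : ∀ t, 0 ≤ pulse A (t + 1 / 2) := fun t => pulse_nonneg A _
  have hsub₁ : Icc (n : ℝ) (n + 1 / 2) ⊆ Icc n (n + 1) := Icc_subset_Icc_right (by linarith)
  have hsub₂ : Icc (n + 1 / 2 : ℝ) (n + 1) ⊆ Icc n (n + 1) := Icc_subset_Icc_left (by linarith)
  have hn₁ : (n : ℝ) ≤ n + 1 / 2 := by linarith
  have hn₂ : (n + 1 / 2 : ℝ) ≤ n + 1 := by linarith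
  have hz₁ := fun i t ht => (hz i t (hsub₁ ht)).mono hsub₁
  have hz₂ := fun i t ht => (hz i t (hsub₂ ht)).mono hsub₂
  have hu₁ := fun j t ht => (hu j t (hsub₁ ht)).mono hsub₁
  have hu₂ := fun j t ht => (hu j t (hsub₂ ht)).mono hsub₂
  have htar : ∀ w : κ → ℝ, ∀ r : ℝ, (∀ i, |w i| ≤ r) → ∀ j, |α j * w (src j) + β j| ≤ a * r + b :=
    fun w r hw j => by
      refine (abs_add_le _ _).trans (add_le_add ?_ (hb j))
      rw [abs_mul]
      exact mul_le_mul (ha j) (hw _) (abs_nonneg _) ha0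
  have hℓ := htar e B he
  have hEsmall : (Bg + B + 1) * (E + η) ≤ 1 :=
    (mul_le_mul_of_nonneg_right hK0 hEη).trans hKE
  -- first half: `z` hardly moves
  have hze : ∀ t ∈ Icc (n : ℝ) (n + 1 / 2), ∀ i, |z t i - e i| ≤ (Bg + B + 1) * (E + η) := by
    intro t ht i
    have hI : ∫ s in (n : ℝ)..t, pulse A (s + 1 / 2) ≤ ε := by
      rw [intervalIntegral.integral_comp_add_right (pulse A) (1 / 2 : ℝ)]
      exact integral_pulse_le hA0 n (by linarith [ht.1]) le_rfl (by linarith [ht.2])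
    have h := abs_relaxation_sub_le_drift (ℓ := e i) (δ := Bg + B) hn₁ hφ₂ hφ₂' (hz₁ i)
      (fun s hs => (abs_sub _ _).trans (add_le_add (hgB s (hsub₁ hs) i) (he i))) ht hI
    have h1 : (Bg + B) * ε ≤ (Bg + B) * η := by gcongr
    have h2 : 0 ≤ (Bg + B) * E := by positivity
    nlinarith [hE i]
  have hz1 : ∀ t ∈ Icc (n : ℝ) (n + 1 / 2), ∀ i, |z t i| ≤ B + 1 := fun t ht i => by
    have h1 := abs_add_le (z t i - e i) (e i)
    rw [sub_add_cancel] at h1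
    linarith [hze t ht i, he i]
  have hu1 : ∀ t ∈ Icc (n : ℝ) (n + 1 / 2), ∀ j, |u t j| ≤ a * (B + 1) + b := fun t ht j => by
    have h := abs_relaxation_sub_le_of_le (ℓ := 0) (δ := a * (B + 1) + b) hφ₁ hφ₁' (hu₁ j)
      (fun s hs => by simpa using htar (z s) (B + 1) (hz1 s hs) j) (by simpa using hun j) ht
    simpa using h
  have hmid₁ : (n + 1 / 2 : ℝ) ∈ Icc (n : ℝ) (n + 1 / 2) := right_mem_Icc.2 hn₁
  have humid : ∀ j, |u (n + 1 / 2) j - (α j * e (src j) + β j)| ≤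
      a * ((Bg + B + 1) * (E + η)) + 2 * (a * (B + 1) + b) * η := fun j => by
    have hexp : exp (-∫ s in (n : ℝ)..(n + 1 / 2), pulse A s) ≤ η :=
      (exp_le_exp.2 (by linarith [le_integral_pulse hA n])).trans hη'
    have h := abs_relaxation_sub_le_contract (ℓ := α j * e (src j) + β j)
      (δ := a * ((Bg + B + 1) * (E + η))) hn₁ hφ₁ hφ₁' (hu₁ j)
      (fun s hs => by
        rw [add_sub_add_right_eq_sub, ← mul_sub, abs_mul]
        exact mul_le_mul (ha j) (hze s hs _) (abs_nonneg _) ha0) hexp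
    have h1 : |u n j - (α j * e (src j) + β j)| ≤ 2 * (a * (B + 1) + b) := by
      refine (abs_sub _ _).trans ?_
      linarith [hun j, hℓ j]
    linarith [mul_le_mul_of_nonneg_right h1 hη0]
  -- second half: `u` hardly moves
  have hzrough : ∀ t ∈ Icc (n + 1 / 2 : ℝ) (n + 1), ∀ i, |z t i| ≤ Bg + B + 1 := fun t ht i => by
    have h := abs_relaxation_sub_le_of_le (ℓ := 0) (δ := Bg + B + 1) hφ₂ hφ₂' (hz₂ i)
      (fun s hs => by rw [sub_zero]; linarith [hgB s (hsub₂ hs) i])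
      (by rw [sub_zero]; linarith [hz1 _ hmid₁ i]) ht
    simpa using h
  have hue : ∀ t ∈ Icc (n + 1 / 2 : ℝ) (n + 1), ∀ j,
      |u t j - (α j * e (src j) + β j)| ≤ C₁ * (E + η) := fun t ht j => by
    have hI : ∫ s in (n + 1 / 2 : ℝ)..t, pulse A s ≤ ε :=
      integral_pulse_le hA0 n ht.1 le_rfl ht.2
    have h := abs_relaxation_sub_le_drift (ℓ := α j * e (src j) + β j)
      (δ := (a * (Bg + B + 1) + b) + (a * (B + 1) + b)) hn₂ hφ₁ hφ₁' (hu₂ j)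
      (fun s hs => (abs_sub _ _).trans
        (add_le_add (htar (z s) _ (hzrough s hs) j) ((hℓ j).trans (by linarith)))) ht hI
    have h1 : ((a * (Bg + B + 1) + b) + (a * (B + 1) + b)) * ε ≤
        ((a * (Bg + B + 1) + b) + (a * (B + 1) + b)) * (E + η) := by
      gcongr
      linarith
    have h2 : 2 * (a * (B + 1) + b) * η ≤ 2 * (a * (B + 1) + b) * (E + η) := by
      gcongr
      linarith
    have h3 := humid j
    rw [hC₁]
    linarith
  have hρ : C₁ * (E + η) ≤ γ / 2 := by
    have h1 := mul_le_mul_of_nonneg_right hK1 hEη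
    have h2 := mul_le_mul_of_nonneg_right hKE (by linarith : 0 ≤ γ / 2)
    linarith
  have hδ : ∀ t ∈ Icc (n + 1 / 2 : ℝ) (n + 1), ∀ i,
      |g t i - e' i| ≤ Kg * (C₁ + 1) * (E + η) := fun t ht i => by
    have h := hge t (hsub₂ ht) _ (by positivity) hρ (hue t ht) i
    refine h.trans ?_
    rw [mul_assoc]
    gcongr
    linarith
  have hδ1 : Kg * (C₁ + 1) * (E + η) ≤ 1 :=
    (mul_le_mul_of_nonneg_right (by linarith) hEη).trans hKE
  have hz2 : ∀ t ∈ Icc (n + 1 / 2 : ℝ) (n + 1), ∀ i, |z t i| ≤ B + 1 := fun t ht i => by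
    have h := abs_relaxation_sub_le_of_le (ℓ := 0) (δ := B + 1) hφ₂ hφ₂' (hz₂ i)
      (fun s hs => by
        rw [sub_zero]
        have h1 := abs_add_le (g s i - e' i) (e' i)
        rw [sub_add_cancel] at h1
        linarith [hδ s hs i, he' i])
      (by rw [sub_zero]; linarith [hz1 _ hmid₁ i]) ht
    simpa using h
  have hu2 : ∀ t ∈ Icc (n + 1 / 2 : ℝ) (n + 1), ∀ j, |u t j| ≤ a * (B + 1) + b := fun t ht j => by
    have h := abs_relaxation_sub_le_of_le (ℓ := 0) (δ := a * (B + 1) + b) hφ₁ hφ₁' (hu₂ j)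
      (fun s hs => by simpa using htar (z s) (B + 1) (hz2 s hs) j)
      (by simpa using hu1 _ hmid₁ j) ht
    simpa using h
  refine ⟨fun i => ?_, fun t ht => ?_⟩
  · have hexp : exp (-∫ s in (n + 1 / 2 : ℝ)..(n + 1), pulse A (s + 1 / 2)) ≤ η := by
      rw [intervalIntegral.integral_comp_add_right (pulse A) (1 / 2 : ℝ)]
      -- The half-period shift turns the second half of this unit of time into the first half of the
      -- next one.
      have h := le_integral_pulse hA (n + 1)
      push_cast at h
      rw [show (n + 1 / 2 + 1 / 2 : ℝ) = n + 1 by ring]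
      exact (exp_le_exp.2 (by linarith)).trans hη'
    have h := abs_relaxation_sub_le_contract (ℓ := e' i) hn₂ hφ₂ hφ₂' (hz₂ i)
      (fun s hs => hδ s hs i) hexp
    have h1 : |z (n + 1 / 2) i - e' i| ≤ 2 * (B + 1) := by
      refine (abs_sub _ _).trans ?_
      linarith [hz1 _ hmid₁ i, he' i]
    have h2 := mul_le_mul_of_nonneg_right h1 hη0
    have h3 := mul_le_mul_of_nonneg_right hK2 hEη
    have h4 : 0 ≤ (B + 1) * E := by positivity
    linarith
  · rcases le_total t (n + 1 / 2) with h | h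
    · exact ⟨hz1 t ⟨ht.1, h⟩, hu1 t ⟨ht.1, h⟩⟩
    · exact ⟨hz2 t ⟨h, ht.2⟩, hu2 t ⟨h, ht.2⟩⟩


/-! ### The sample-and-hold loop over many steps -/

theorem abs_clamp_sub_le {R ℓ : ℝ} (hℓ : |ℓ| ≤ R) (x : ℝ) :
    |max (-R) (min R x) - ℓ| ≤ |x - ℓ| := by
  have h := abs_le.1 hℓ
  rcases le_total x ℓ with hx | hx
  · rw [abs_of_nonpos (by linarith : x - ℓ ≤ 0),
      abs_of_nonpos (by linarith [max_le h.1 ((min_le_right R x).trans hx)])]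
    rw [min_eq_right (hx.trans h.2)]
    linarith [le_max_right (-R) x]
  · rw [abs_of_nonneg (by linarith : 0 ≤ x - ℓ),
      abs_of_nonneg (by linarith [(le_min h.2 hx).trans (le_max_right (-R) (min R x))])]
    have := max_le (h.1.trans hx) (min_le_right R x)
    linarith

theorem abs_sigmoid_sub_one_le (x : ℝ) : |sigmoid x - 1| ≤ exp (-x) := by
  rw [abs_sub_comm, abs_of_nonneg (by linarith [sigmoid_le_one x]), ← sigmoid_neg,
    ← sigmoid_mul_rexp_neg]
  exact mul_le_of_le_one_left (exp_pos _).le (sigmoid_le_one x)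

theorem abs_sigmoid_le (x : ℝ) : |sigmoid x| ≤ exp x := by
  have h := abs_sigmoid_sub_one_le (-x)
  rwa [sigmoid_neg, neg_neg, sub_sub_cancel_left, abs_neg] at h

/-- A steep sigmoid approximates the indicator function of the positive reals. -/
theorem abs_sigmoid_sub_indicator_le {A γ ℓ v : ℝ} (hA : 0 ≤ A) (hℓ : γ ≤ |ℓ|)
    (hv : |v - ℓ| ≤ γ / 2) :
    |sigmoid (A * v) - if 0 < ℓ then 1 else 0| ≤ exp (-(γ / 2 * A)) := by
  have hv' := abs_le.1 hv
  split_ifs with h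
  · rw [abs_of_pos h] at hℓ
    refine (abs_sigmoid_sub_one_le _).trans (exp_le_exp.2 ?_)
    nlinarith
  · rw [abs_of_nonpos (not_lt.1 h)] at hℓ
    rw [sub_zero]
    refine (abs_sigmoid_le _).trans (exp_le_exp.2 ?_)
    nlinarith

/-- The vector field of the sample-and-hold loop, with the argument of the update clamped. -/
noncomputable def loopField {ι J : Type*} (src : J → ι) (α β : J → ℝ)
    (H : (J → ℝ) → ι → ℝ) (A t : ℝ) (x : ι ⊕ J → ℝ) : ι ⊕ J → ℝ :=
  Sum.elim (fun i => pulse A (t + 1 / 2) * (H (fun j => x (.inr j)) i - x (.inl i)))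
    (fun j => pulse A t * (α j * x (.inl (src j)) + β j - x (.inr j)))

theorem lipschitzWith_loopField {ι J : Type*} [Fintype ι] [Fintype J] (src : J → ι) {α : J → ℝ}
    (β : J → ℝ) {H : (J → ℝ) → ι → ℝ} {K : NNReal} (hH : LipschitzWith K H) {A a : ℝ} (hA : 0 ≤ A)
    (ha : ∀ j, |α j| ≤ a) (ha0 : 0 ≤ a) (t : ℝ) :
    LipschitzWith (Real.toNNReal (A ^ 2 * (K + a + 1))) (loopField src α β H A t) := by
  refine LipschitzWith.of_dist_le_mul fun x y => ?_
  rw [Real.coe_toNNReal _ (by positivity), dist_pi_le_iff (by positivity)]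
  have hx : ∀ k, |x k - y k| ≤ dist x y := fun k => by
    rw [← Real.dist_eq]
    exact dist_le_pi_dist x y k
  rintro (i | j)
  · have h1 : |H (fun j => x (.inr j)) i - H (fun j => y (.inr j)) i| ≤ K * dist x y := by
      rw [← Real.dist_eq]
      refine (dist_le_pi_dist _ _ i).trans ((hH.dist_le_mul _ _).trans ?_)
      gcongr
      rw [dist_pi_le_iff dist_nonneg]
      exact fun j => dist_le_pi_dist x y _
    simp only [loopField, Sum.elim_inl, Real.dist_eq]
    rw [← mul_sub, abs_mul, abs_of_nonneg (pulse_nonneg _ _), mul_assoc (A ^ 2)]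
    refine mul_le_mul (pulse_le hA _) ?_ (abs_nonneg _) (by positivity)
    rw [sub_sub_sub_comm]
    refine (abs_sub _ _).trans ?_
    nlinarith [hx (.inl i), mul_nonneg ha0 (dist_nonneg (x := x) (y := y))]
  · simp only [loopField, Sum.elim_inr, Real.dist_eq]
    rw [← mul_sub, abs_mul, abs_of_nonneg (pulse_nonneg _ _), mul_assoc (A ^ 2)]
    refine mul_le_mul (pulse_le hA _) ?_ (abs_nonneg _) (by positivity)
    rw [sub_sub_sub_comm, add_sub_add_right_eq_sub, ← mul_sub]
    refine (abs_sub _ _).trans ?_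
    rw [abs_mul]
    have h2 := mul_le_mul (ha j) (hx (.inl (src j))) (abs_nonneg _) ha0
    nlinarith [hx (.inr j), mul_nonneg K.coe_nonneg (dist_nonneg (x := x) (y := y))]

theorem continuous_loopField {ι J : Type*} [Fintype ι] [Fintype J] (src : J → ι) (α β : J → ℝ)
    (H : (J → ℝ) → ι → ℝ) (A : ℝ) (x : ι ⊕ J → ℝ) :
    Continuous fun t => loopField src α β H A t x := by
  have h := continuous_pulse A
  refine continuous_pi ?_
  rintro (i | j) <;> simp only [loopField, Sum.elim_inl, Sum.elim_inr] <;> fun_prop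

/-- The recursion `E ↦ K * (E + η)` preserves the bound `(2 * K) ^ n * η`, because `(2 * K) ^ n ≥
1`. The smallness assumption keeps every such error at most `1`, as each single step requires. -/
theorem loop_bounds {C ι J : Type*} {src : J → ι} {α β : J → ℝ} {step : C → C} {enc : C → ι → ℝ}
    {H : (J → ℝ) → ι → ℝ} {y : ℝ → ι ⊕ J → ℝ} {N : ℕ} {A a b B Bg Kg γ η K : ℝ} (hA : 1 ≤ A)
    (ha : ∀ j, |α j| ≤ a) (hb : ∀ j, |β j| ≤ b) (ha0 : 0 ≤ a) (hb0 : 0 ≤ b)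
    (hB0 : 0 ≤ B) (hBg0 : 0 ≤ Bg) (hKg : 0 ≤ Kg) (hγ : 0 < γ)
    (hη1 : A ^ 2 * exp (-A) ≤ η) (hη2 : exp (-(A / 8)) ≤ η)
    (hz : ∀ t ∈ Icc (0 : ℝ) N, ∀ i, HasDerivWithinAt (fun t => y t (.inl i))
      (pulse A (t + 1 / 2) * (H (fun j => y t (.inr j)) i - y t (.inl i))) (Icc 0 N) t)
    (hu : ∀ t ∈ Icc (0 : ℝ) N, ∀ j, HasDerivWithinAt (fun t => y t (.inr j))
      (pulse A t * (α j * y t (.inl (src j)) + β j - y t (.inr j))) (Icc 0 N) t)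
    (hB : ∀ c i, |enc c i| ≤ B) (hgB : ∀ v i, |H v i| ≤ Bg)
    (hgstep : ∀ (c : C) (v : J → ℝ) (ρ : ℝ), 0 ≤ ρ → ρ ≤ γ / 2 →
      (∀ j, |v j - (α j * enc c (src j) + β j)| ≤ ρ) →
      ∀ i, |H v i - enc (step c) i| ≤ Kg * (ρ + η))
    (hK1 : 1 ≤ K) (hK : Bg + B + 1 ≤ K)
    (hKγ : (a * (Bg + B + 1) + b) + (a * (B + 1) + b) + a * (Bg + B + 1) + 2 * (a * (B + 1) + b)
      ≤ K * (γ / 2))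
    (hKg' : Kg * ((a * (Bg + B + 1) + b) + (a * (B + 1) + b) + a * (Bg + B + 1) +
      2 * (a * (B + 1) + b) + 1) + 2 * (B + 1) ≤ K)
    (hsmall : (2 * K) ^ (N + 1) * η ≤ 1) {c : C} (hy0 : ∀ i, y 0 (.inl i) = enc c i)
    (hy0' : ∀ j, y 0 (.inr j) = 0) (n : ℕ) (hn : n ≤ N) :
    (∀ t ∈ Icc (0 : ℝ) n, (∀ i, |y t (.inl i)| ≤ B + 1) ∧
      ∀ j, |y t (.inr j)| ≤ a * (B + 1) + b) ∧
      ∀ i, |y n (.inl i) - enc (step^[n] c) i| ≤ (2 * K) ^ n * η := by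
  have hη0 : 0 ≤ η := (exp_pos _).le.trans hη2
  induction n with
  | zero =>
    have h0 : ∀ t ∈ Icc (0 : ℝ) (0 : ℕ), t = 0 := fun t ht => by
      simpa using ht
    refine ⟨fun t ht => ?_, fun i => ?_⟩
    · rw [h0 t ht]
      refine ⟨fun i => ?_, fun j => ?_⟩
      · rw [hy0]
        exact (hB c i).trans (by linarith)
      · rw [hy0', abs_zero]
        positivity
    · simp [hy0, hη0]
  | succ n ih =>
    obtain ⟨ih1, ih2⟩ := ih (by omega)
    have hnN : (n : ℝ) + 1 ≤ N := by exact_mod_cast hn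
    have hn0 : (0 : ℝ) ≤ n := n.cast_nonneg
    have hsub : Icc (n : ℝ) (n + 1) ⊆ Icc 0 N := Icc_subset_Icc hn0 hnN
    have hpow : 1 ≤ (2 * K) ^ n := one_le_pow₀ (by linarith)
    have hle : K * ((2 * K) ^ n * η + η) ≤ (2 * K) ^ (n + 1) * η := by
      rw [pow_succ]
      nlinarith [mul_nonneg (by linarith : 0 ≤ K) hη0,
        mul_le_mul_of_nonneg_right hpow (mul_nonneg (by linarith : 0 ≤ K) hη0)]
    have hle1 : (2 * K) ^ (n + 1) * η ≤ 1 := by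
      refine le_trans ?_ hsmall
      gcongr
      · linarith
      · omega
    obtain ⟨h1, h2⟩ := abs_sub_le_of_two_phases (κ := ι) (src := src) (α := α) (β := β) hA n
      (z := fun t i => y t (.inl i)) (u := fun t j => y t (.inr j))
      (g := fun t => H fun j => y t (.inr j))
      (e := enc (step^[n] c)) (e' := enc (step (step^[n] c))) (B := B) (Bg := Bg) (Kg := Kg)
      (γ := γ) (η := η) (E := (2 * K) ^ n * η) (K := K) ha hb ha0 hb0 hB0 hBg0 hKg hγ hη1 hη2
      (fun i t ht => (hz t (hsub ht) i).mono hsub) (fun j t ht => (hu t (hsub ht) j).mono hsub)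
      (hB _) (hB _) (fun t _ => hgB _) (fun t _ => hgstep _ _) ih2 (by positivity)
      (ih1 n ⟨hn0, le_rfl⟩).2 hK hKγ hKg' (hle.trans hle1)
    refine ⟨fun t ht => ?_, fun i => ?_⟩
    · push_cast at ht
      rcases le_total t n with h | h
      · exact ih1 t ⟨ht.1, h⟩
      · exact h2 t ⟨h, ht.2⟩
    · rw [Function.iterate_succ_apply']
      push_cast
      exact (h1 i).trans hle

/-- A discrete system whose update is polynomial in affine readouts of the encoded state and
their signs is followed by a sample-and-hold loop, with an error that is exponentially small in
the steepness `A`. -/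
theorem exists_loop {C ι J : Type*} [Fintype ι] [Fintype J] (src : J → ι) (α β : J → ℝ)
    (G : ι → MvPolynomial (J ⊕ J) ℝ) (step : C → C) (enc : C → ι → ℝ) {B γ : ℝ} (hB0 : 0 ≤ B)
    (hB : ∀ c i, |enc c i| ≤ B) (hγ : 0 < γ)
    (hsep : ∀ c j, γ ≤ |α j * enc c (src j) + β j|)
    (hG : ∀ c i, MvPolynomial.eval (Sum.elim (fun j => α j * enc c (src j) + β j)
      fun j => if 0 < α j * enc c (src j) + β j then 1 else 0) (G i) = enc (step c) i) :
    ∃ κ > 0, ∃ K ≥ 1, ∃ R ≥ 0, ∀ A ≥ 1, ∀ N : ℕ, K ^ (N + 1) * (A ^ 2 * exp (-(κ * A))) ≤ 1 →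
      ∀ c, ∃ (z : ℝ → ι → ℝ) (u : ℝ → J → ℝ), z 0 = enc c ∧ u 0 = 0 ∧
        (∀ t ∈ Icc (0 : ℝ) N, ∀ i, HasDerivWithinAt (fun t => z t i) (pulse A (t + 1 / 2) *
          (MvPolynomial.eval (Sum.elim (u t) fun j => sigmoid (A * u t j)) (G i) - z t i))
          (Icc 0 N) t) ∧
        (∀ t ∈ Icc (0 : ℝ) N, ∀ j, HasDerivWithinAt (fun t => u t j) (pulse A t *
          (α j * z t (src j) + β j - u t j)) (Icc 0 N) t) ∧
        (∀ t ∈ Icc (0 : ℝ) N, (∀ i, |z t i| ≤ R) ∧ ∀ j, |u t j| ≤ R) ∧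
        ∀ n ≤ N, ∀ i, |z n i - enc (step^[n] c) i| ≤ K ^ n * (A ^ 2 * exp (-(κ * A))) := by
  classical
  obtain ⟨a, ha0, ha⟩ : ∃ a, 0 ≤ a ∧ ∀ j, |α j| ≤ a := ⟨‖α‖, norm_nonneg _, norm_le_pi_norm α⟩
  obtain ⟨b, hb0, hb⟩ : ∃ b, 0 ≤ b ∧ ∀ j, |β j| ≤ b := ⟨‖β‖, norm_nonneg _, norm_le_pi_norm β⟩
  set R := a * (B + 1) + b with hR
  have hR0 : 0 ≤ R := by positivity
  obtain ⟨Kg, hKg⟩ := exists_lipschitzOnWith_closedBall (contDiff_eval_pi G) (R + 1)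
  obtain ⟨Bg, hBg⟩ := (isCompact_closedBall (0 : J ⊕ J → ℝ) (R + 1)).exists_bound_of_continuousOn
    hKg.continuousOn
  have hBg0 : 0 ≤ Bg :=
    (norm_nonneg _).trans (hBg 0 (Metric.mem_closedBall_self (by positivity)))
  set C₁ := (a * (Bg + B + 1) + b) + (a * (B + 1) + b) + a * (Bg + B + 1) + 2 * (a * (B + 1) + b)
    with hC₁
  have hC₁0 : 0 ≤ C₁ := by positivity
  -- Each of the three nonnegative groups secures one of the lower bounds on `K` in `loop_bounds`.
  -- None of them involves `A`.
  set K := (Bg + B + 1) + C₁ / (γ / 2) + (Kg * (C₁ + 1) + 2 * (B + 1)) with hK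
  have hdiv : 0 ≤ C₁ / (γ / 2) := by positivity
  have hKg2 : 0 ≤ Kg * (C₁ + 1) + 2 * (B + 1) := by positivity
  have hK1 : 1 ≤ K := by linarith
  have hKγ : C₁ ≤ K * (γ / 2) := by
    have h1 : C₁ / (γ / 2) * (γ / 2) = C₁ := by field_simp
    nlinarith
  -- The slowest exponential rate: `1 / 8` comes from the active pulse, `γ / 2` from the sigmoids;
  -- the leak of the idle pulse has rate `1`.
  refine ⟨min (1 / 8) (γ / 2), by positivity, 2 * K, by linarith, max (B + 1) R,
    le_max_of_le_right hR0, fun A hA N hsmall c => ?_⟩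
  have hA0 : 0 ≤ A := by linarith
  set κ := min (1 / 8 : ℝ) (γ / 2) with hκ
  set η := A ^ 2 * exp (-(κ * A)) with hη
  have hη0 : 0 ≤ η := by positivity
  have hκ1 : κ ≤ 1 / 8 := min_le_left _ _
  have hκ2 : κ ≤ γ / 2 := min_le_right _ _
  have hexpη : exp (-(κ * A)) ≤ η := le_mul_of_one_le_left (exp_pos _).le (one_le_pow₀ hA)
  have hη1 : A ^ 2 * exp (-A) ≤ η := by
    rw [hη]
    gcongr
    nlinarith
  have hη2 : exp (-(A / 8)) ≤ η := (exp_le_exp.2 (by nlinarith)).trans hexpη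
  have hη3 : exp (-(γ / 2 * A)) ≤ η := (exp_le_exp.2 (by nlinarith)).trans hexpη
  -- Clamping the readouts makes the field globally Lipschitz, so a solution exists before any bound
  -- on it is known. Exact readouts lie within `R` and are unaffected.
  set cl : (J → ℝ) → J → ℝ := fun v j => max (-R) (min R (v j)) with hcl
  have hclR : ∀ v j, |cl v j| ≤ R := fun v j => abs_clamp_le hR0 _
  set S : (J → ℝ) → ι → ℝ := fun v i =>
    MvPolynomial.eval (Sum.elim v fun j => sigmoid (A * v j)) (G i) with hS
  have hSd : ContDiff ℝ 1 S := by
    refine (contDiff_eval_pi G).comp (contDiff_pi.2 ?_)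
    rintro (j | j)
    · exact contDiff_apply ℝ ℝ j
    · exact (contDiff_sigmoid.of_le le_top).comp (contDiff_const.mul (contDiff_apply ℝ ℝ j))
  -- `KS` may depend on `A`, since it serves existence only. The error estimate uses `Kg`, the
  -- Lipschitz constant of `G` with the sigmoids as separate arguments.
  obtain ⟨KS, hKS⟩ := exists_lipschitzOnWith_closedBall hSd R
  have hH : LipschitzWith KS (fun v => S (cl v)) := by
    have h := hKS.comp (lipschitzWith_clamp R).lipschitzOnWith (s := univ) (fun v _ => by
      rw [mem_closedBall_zero_iff, pi_norm_le_iff_of_nonneg hR0]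
      exact hclR v)
    rw [mul_one] at h
    exact lipschitzOnWith_univ.1 h
  obtain ⟨y, hy0, hy⟩ := exists_hasDerivWithinAt_of_lipschitzWith (T := N) (by positivity)
    (fun t _ => lipschitzWith_loopField src β hH hA0 ha ha0 t)
    (fun x => (continuous_loopField src α β (fun v => S (cl v)) A x).continuousOn)
    (Sum.elim (enc c) 0)
  have hz : ∀ t ∈ Icc (0 : ℝ) N, ∀ i, HasDerivWithinAt (fun t => y t (.inl i))
      (pulse A (t + 1 / 2) * (S (cl fun j => y t (.inr j)) i - y t (.inl i))) (Icc 0 N) t :=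
    fun t ht i => hasDerivWithinAt_pi.1 (hy t ht) (.inl i)
  have hu : ∀ t ∈ Icc (0 : ℝ) N, ∀ j, HasDerivWithinAt (fun t => y t (.inr j))
      (pulse A t * (α j * y t (.inl (src j)) + β j - y t (.inr j))) (Icc 0 N) t :=
    fun t ht j => hasDerivWithinAt_pi.1 (hy t ht) (.inr j)
  have hlin : ∀ c j, |α j * enc c (src j) + β j| ≤ R := fun c j => by
    refine (abs_add_le _ _).trans (add_le_add ?_ (hb j))
    rw [abs_mul]
    exact mul_le_mul (ha j) ((hB _ _).trans (by linarith)) (abs_nonneg _) ha0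
  have hmem : ∀ (v s : J → ℝ), (∀ j, |v j| ≤ R) → (∀ j, |s j| ≤ 1) →
      Sum.elim v s ∈ Metric.closedBall (0 : J ⊕ J → ℝ) (R + 1) := fun v s hv hs => by
    rw [mem_closedBall_zero_iff, pi_norm_le_iff_of_nonneg (by linarith)]
    rintro (j | j)
    · exact (hv j).trans (by linarith)
    · exact (hs j).trans (by linarith)
  have hsig : ∀ x, |sigmoid x| ≤ 1 := fun x => by
    rw [abs_of_pos (sigmoid_pos x)]
    exact sigmoid_le_one x
  have hgB : ∀ v i, |S (cl v) i| ≤ Bg := fun v i =>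
    (norm_le_pi_norm _ i).trans (hBg _ (hmem _ _ (hclR v) fun j => hsig _))
  have hgstep : ∀ (c : C) (v : J → ℝ) (ρ : ℝ), 0 ≤ ρ → ρ ≤ γ / 2 →
      (∀ j, |v j - (α j * enc c (src j) + β j)| ≤ ρ) →
      ∀ i, |S (cl v) i - enc (step c) i| ≤ Kg * (ρ + η) := fun c v ρ hρ0 hρ hv i => by
    have hcv : ∀ j, |cl v j - (α j * enc c (src j) + β j)| ≤ ρ := fun j =>
      (abs_clamp_sub_le (hlin c j) (v j)).trans (hv j)
    have h1 := hKg.dist_le_mul _ (hmem (cl v) (fun j => sigmoid (A * cl v j)) (hclR v)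
      fun j => hsig _) _ (hmem (fun j => α j * enc c (src j) + β j)
      (fun j => if 0 < α j * enc c (src j) + β j then 1 else 0) (hlin c)
      fun j => by split_ifs <;> simp)
    have h2 := (dist_le_pi_dist _ _ i).trans h1
    rw [hG, Real.dist_eq] at h2
    refine h2.trans ?_
    gcongr
    rw [dist_pi_le_iff (by positivity)]
    rintro (j | j)
    · rw [Real.dist_eq]
      exact (hcv j).trans (by linarith)
    · rw [Real.dist_eq]
      have := abs_sigmoid_sub_indicator_le hA0 (hsep c j) ((hcv j).trans hρ)
      simp only [Sum.elim_inr]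
      linarith
  have main := loop_bounds hA ha hb ha0 hb0 hB0 hBg0 Kg.coe_nonneg hγ hη1 hη2 hz hu hB hgB hgstep
    hK1 (by linarith) hKγ (by linarith) hsmall (c := c) (fun i => by simp [hy0])
    (fun j => by simp [hy0])
  refine ⟨fun t i => y t (.inl i), fun t j => y t (.inr j), ?_, ?_, fun t ht i => ?_, hu,
    fun t ht => ?_, fun n hn => (main n hn).2⟩
  · simp [hy0]
  · funext j
    simp [hy0]
  · have hcu : (cl fun j => y t (.inr j)) = fun j => y t (.inr j) := by
      funext j
      exact clamp_eq_self (((main N le_rfl).1 t ht).2 j)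
    have h := hz t ht i
    rw [hcu] at h
    exact h
  · exact ⟨fun i => (((main N le_rfl).1 t ht).1 i).trans (le_max_left _ _),
      fun j => (((main N le_rfl).1 t ht).2 j).trans (le_max_right _ _)⟩

end ODE

/-! ### The update of a machine as a polynomial -/

section Interpolation

open MvPolynomial Finset

/-- The Lagrange basis polynomial of the node `a` among `0, …, n - 1`, at the polynomial `Q`. -/
noncomputable def lagrangeBasis {σ : Type*} {n : ℕ} (a : Fin n) (Q : MvPolynomial σ ℝ) :
    MvPolynomial σ ℝ :=
  ∏ b ∈ univ.erase a, C (((a : ℕ) : ℝ) - ((b : ℕ) : ℝ))⁻¹ * (Q - C ((b : ℕ) : ℝ))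

theorem eval_lagrangeBasis {σ : Type*} {n : ℕ} (a c : Fin n) {Q : MvPolynomial σ ℝ} {v : σ → ℝ}
    (h : eval v Q = ((c : ℕ) : ℝ)) : eval v (lagrangeBasis a Q) = if a = c then 1 else 0 := by
  simp only [lagrangeBasis, map_prod, map_mul, map_sub, eval_C, h]
  split_ifs with hac
  · subst hac
    refine prod_eq_one fun b hb => inv_mul_cancel₀ (sub_ne_zero.2 fun hab => ?_)
    exact (Finset.mem_erase.1 hb).1 (Fin.ext (by exact_mod_cast hab.symm))
  · refine prod_eq_zero (i := c) (Finset.mem_erase.2 ⟨fun h => hac h.symm, mem_univ _⟩) (by simp)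

/-- Selection of the branch `f q s` by polynomials `Q` and `S` that take the values `q` and `s`. -/
noncomputable def branch {σ : Type*} {m n : ℕ} (f : Fin m → Fin n → MvPolynomial σ ℝ)
    (Q S : MvPolynomial σ ℝ) : MvPolynomial σ ℝ :=
  ∑ q, ∑ s, lagrangeBasis q Q * lagrangeBasis s S * f q s

theorem eval_branch {σ : Type*} {m n : ℕ} (f : Fin m → Fin n → MvPolynomial σ ℝ)
    {Q S : MvPolynomial σ ℝ} {v : σ → ℝ} {q : Fin m} {s : Fin n}
    (hQ : eval v Q = ((q : ℕ) : ℝ)) (hS : eval v S = ((s : ℕ) : ℝ)) :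
    eval v (branch f Q S) = eval v (f q s) := by
  simp only [branch, map_sum, map_mul, eval_lagrangeBasis _ q hQ, eval_lagrangeBasis _ s hS]
  rw [sum_eq_single q, sum_eq_single s] <;> simp +contextual

end Interpolation

/-! ### Reading the first digit of a half tape -/

section Digits

variable {r : ℕ} (L : ListBlank (Fin (r + 1)))

/-- An affine function of the fraction of a half tape whose sign tells whether the first digit
exceeds `j`. -/
theorem threshold_cases (j : ℕ) :
    (j < (L.head : ℕ) ∧ 1 / (2 * ((r : ℝ) + 1)) ≤
      ((r : ℝ) + 2) * fraction (r + 2) L + (1 / (2 * ((r : ℝ) + 1)) - (j + 1))) ∨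
    ((L.head : ℕ) ≤ j ∧ ((r : ℝ) + 2) * fraction (r + 2) L + (1 / (2 * ((r : ℝ) + 1)) - (j + 1)) ≤
      -(1 / (2 * ((r : ℝ) + 1)))) := by
  have ht := fraction_tail L
  have hb := fraction_mem_Icc L.tail
  -- Scaling by `r + 2` gives the digit plus a remainder in `[0, 1 - 2 * margin]`. The threshold `j
  -- + 1 - margin` is the middle of the gap below `j + 1`.
  have h1 : (r : ℝ) / (r + 1) = 1 - 2 * (1 / (2 * ((r : ℝ) + 1))) := by field_simp; ring
  rw [h1] at hb
  rcases lt_or_ge j (L.head : ℕ) with h | h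
  · left
    have h2 : (j : ℝ) + 1 ≤ ((L.head : ℕ) : ℝ) := by exact_mod_cast h
    exact ⟨h, by linarith [hb.1]⟩
  · right
    have h2 : ((L.head : ℕ) : ℝ) ≤ j := by exact_mod_cast h
    exact ⟨h, by linarith [hb.2]⟩

theorem le_abs_threshold (j : ℕ) : 1 / (2 * ((r : ℝ) + 1)) ≤
    |((r : ℝ) + 2) * fraction (r + 2) L + (1 / (2 * ((r : ℝ) + 1)) - (j + 1))| := by
  rcases threshold_cases L j with h | h
  · exact h.2.trans (le_abs_self _)
  · exact (le_neg_of_le_neg h.2).trans (neg_le_abs _)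

theorem threshold_pos_iff (j : ℕ) :
    0 < ((r : ℝ) + 2) * fraction (r + 2) L + (1 / (2 * ((r : ℝ) + 1)) - (j + 1)) ↔
      j < (L.head : ℕ) := by
  have h0 : 0 < 1 / (2 * ((r : ℝ) + 1)) := by positivity
  rcases threshold_cases L j with h | h
  · exact ⟨fun _ => h.1, fun _ => h0.trans_le h.2⟩
  · exact ⟨fun h' => absurd h' (by linarith [h.2]), fun h' => absurd h' (by omega)⟩

/-- A digit is at most `r`, hence equals the number of `j < r` below it. -/
theorem sum_threshold : (∑ j : Fin r, if 0 < ((r : ℝ) + 2) * fraction (r + 2) L +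
    (1 / (2 * ((r : ℝ) + 1)) - (((j : ℕ) : ℝ) + 1)) then (1 : ℝ) else 0) = ((L.head : ℕ) : ℝ) := by
  simp only [threshold_pos_iff]
  rw [Fin.sum_univ_eq_sum_range (fun j => if j < (L.head : ℕ) then (1 : ℝ) else 0),
    Finset.sum_boole]
  congr 1
  have h : (Finset.range r).filter (fun j => j < (L.head : ℕ)) = Finset.range (L.head : ℕ) := by
    ext j
    have := L.head.2
    simp only [Finset.mem_filter, Finset.mem_range]
    omega
  rw [h, Finset.card_range]

end Digits

/-! ### One machine step as a polynomial in readouts and signs -/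

namespace Machine

open MvPolynomial

variable (M : Machine)

/-- The affine readouts of an encoding: the four coordinates, and for each half tape the
thresholds of its first digit. -/
abbrev Readout : Type := Fin 4 ⊕ (Fin M.nonblank ⊕ Fin M.nonblank)

/-- The coordinate that a readout depends on. -/
def readoutSource : M.Readout → Fin 4
  | .inl i => i
  | .inr (.inl _) => 0
  | .inr (.inr _) => 2

/-- The slope of a readout. -/
def readoutSlope : M.Readout → ℝ
  | .inl _ => 1
  | .inr _ => M.nonblank + 2

/-- The constant term of a readout. -/
noncomputable def readoutOffset : M.Readout → ℝ
  | .inl _ => 1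
  | .inr (.inl j) => 1 / (2 * ((M.nonblank : ℝ) + 1)) - (((j : ℕ) : ℝ) + 1)
  | .inr (.inr j) => 1 / (2 * ((M.nonblank : ℝ) + 1)) - (((j : ℕ) : ℝ) + 1)

/-- The coordinates of an encoding, from the readouts. -/
noncomputable def coordinate (i : Fin 4) : MvPolynomial (M.Readout ⊕ M.Readout) ℝ :=
  X (.inl (.inl i)) - 1

/-- The first symbol to the left of the head, from the signs of the readouts. -/
noncomputable def leftDigit : MvPolynomial (M.Readout ⊕ M.Readout) ℝ :=
  ∑ j, X (.inr (.inr (.inl j)))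

/-- The first symbol to the right of the head, from the signs of the readouts. -/
noncomputable def rightDigit : MvPolynomial (M.Readout ⊕ M.Readout) ℝ :=
  ∑ j, X (.inr (.inr (.inr j)))

/-- The encoding after a step that enters `q`, writes `s` and moves in the given direction. -/
noncomputable def moved (q : Fin M.states) (s : M.Symbol) :
    Dir → Fin 4 → MvPolynomial (M.Readout ⊕ M.Readout) ℝ
  | .left => ![C ((M.nonblank : ℝ) + 2) * M.coordinate 0 - M.leftDigit, M.leftDigit,
      C ((M.nonblank : ℝ) + 2)⁻¹ * (C ((s : ℕ) : ℝ) + M.coordinate 2), C ((q : ℕ) : ℝ)]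
  | .right => ![C ((M.nonblank : ℝ) + 2)⁻¹ * (C ((s : ℕ) : ℝ) + M.coordinate 0), M.rightDigit,
      C ((M.nonblank : ℝ) + 2) * M.coordinate 2 - M.rightDigit, C ((q : ℕ) : ℝ)]

/-- The encoding after one step, as a polynomial in the readouts and their signs. -/
noncomputable def update (i : Fin 4) : MvPolynomial (M.Readout ⊕ M.Readout) ℝ :=
  branch (fun q s => if q ∈ M.final then M.coordinate i
    else M.moved (M.trans q s).1 (M.trans q s).2.1 (M.trans q s).2.2 i)
    (M.coordinate 3) (M.coordinate 1)

theorem abs_encode_le (c : M.Config) (i : Fin 4) :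
    |M.encode c i| ≤ M.nonblank + M.states + 1 := by
  have hr : (M.nonblank : ℝ) / (M.nonblank + 1) ≤ 1 := by
    rw [div_le_one (by positivity)]
    linarith
  have hl := fraction_mem_Icc c.tape.left
  have hri := fraction_mem_Icc c.tape.right
  have hs : ((c.tape.head : ℕ) : ℝ) ≤ M.nonblank := by
    exact_mod_cast Nat.lt_succ_iff.1 c.tape.head.2
  have hq : ((c.state : ℕ) : ℝ) ≤ M.states := by exact_mod_cast c.state.2.le
  have h1 : (0 : ℝ) ≤ M.nonblank := M.nonblank.cast_nonneg
  have h2 : (0 : ℝ) ≤ M.states := M.states.cast_nonneg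
  fin_cases i <;> simp only [encode, base, Fin.zero_eta, Fin.mk_one, Fin.reduceFinMk,
    Matrix.cons_val]
  · rw [abs_of_nonneg hl.1]
    linarith [hl.2]
  · rw [abs_of_nonneg (Nat.cast_nonneg _)]
    linarith
  · rw [abs_of_nonneg hri.1]
    linarith [hri.2]
  · rw [abs_of_nonneg (Nat.cast_nonneg _)]
    linarith

theorem encode_nonneg (c : M.Config) (i : Fin 4) : 0 ≤ M.encode c i := by
  fin_cases i <;> simp only [encode, base, Fin.zero_eta, Fin.mk_one, Fin.reduceFinMk,
    Matrix.cons_val]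
  · exact (fraction_mem_Icc c.tape.left).1
  · exact Nat.cast_nonneg _
  · exact (fraction_mem_Icc c.tape.right).1
  · exact Nat.cast_nonneg _

/-- The margin needed by the sigmoids. Coordinates may vanish but are nonnegative, so the offset `1`
keeps their readouts away from `0` too; `coordinate` subtracts it again. -/
theorem le_abs_readout (c : M.Config) (j : M.Readout) : 1 / (2 * ((M.nonblank : ℝ) + 1)) ≤
    |M.readoutSlope j * M.encode c (M.readoutSource j) + M.readoutOffset j| := by
  rcases j with i | j | j
  · have h : 1 / (2 * ((M.nonblank : ℝ) + 1)) ≤ 1 := by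
      rw [div_le_one (by positivity)]
      linarith [(M.nonblank.cast_nonneg : (0 : ℝ) ≤ _)]
    refine h.trans (le_trans ?_ (le_abs_self _))
    simp only [readoutSlope, readoutSource, readoutOffset]
    linarith [M.encode_nonneg c i]
  · exact le_abs_threshold c.tape.left j
  · exact le_abs_threshold c.tape.right j

/-- Pushing a symbol `s` is `x ↦ (s + x) / k`, popping a digit `d` is `x ↦ k * x - d`. Both are
polynomial once `d` is known, and interpolation in state and scanned symbol selects the transition.
-/
theorem eval_update (c : M.Config) (i : Fin 4) :
    eval (Sum.elim
      (fun j => M.readoutSlope j * M.encode c (M.readoutSource j) + M.readoutOffset j)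
      fun j => if 0 < M.readoutSlope j * M.encode c (M.readoutSource j) + M.readoutOffset j
        then 1 else 0) (M.update i) = M.encode (M.step c) i := by
  set v : M.Readout ⊕ M.Readout → ℝ := Sum.elim
      (fun j => M.readoutSlope j * M.encode c (M.readoutSource j) + M.readoutOffset j)
      (fun j => if 0 < M.readoutSlope j * M.encode c (M.readoutSource j) + M.readoutOffset j
        then 1 else 0) with hv
  have hcoord : ∀ i, eval v (M.coordinate i) = M.encode c i := fun i => by
    simp [coordinate, hv, readoutSlope, readoutSource, readoutOffset]
  have hleft : eval v M.leftDigit = ((c.tape.left.head : ℕ) : ℝ) := by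
    simp only [leftDigit, map_sum, eval_X]
    exact sum_threshold c.tape.left
  have hright : eval v M.rightDigit = ((c.tape.right.head : ℕ) : ℝ) := by
    simp only [rightDigit, map_sum, eval_X]
    exact sum_threshold c.tape.right
  rw [update, eval_branch _ (q := c.state) (s := c.tape.head) (by rw [hcoord]; rfl)
    (by rw [hcoord]; rfl)]
  unfold step
  split_ifs with hf
  · exact hcoord i
  · obtain ⟨q, a, l, r⟩ := c
    simp only at hcoord hleft hright ⊢
    obtain ⟨q', s', d⟩ := M.trans q a
    have h0 : eval v (M.coordinate 0) = fraction (M.nonblank + 2) l := hcoord 0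
    have h2 : eval v (M.coordinate 2) = fraction (M.nonblank + 2) r := hcoord 2
    cases d <;> fin_cases i <;>
      simp [moved, encode, Tape.move, Tape.write, base, h0, h2, hleft, hright, fraction_tail,
        fraction_cons, div_eq_inv_mul]

end Machine

/-! ### The polynomial system -/

section System

open MvPolynomial

variable {J : Type} (src : J → Fin 4) (α β : J → ℝ) (G : Fin 4 → MvPolynomial (J ⊕ J) ℝ)

/-- The auxiliary unknowns: the sampled readouts, their steep sigmoids, and
`(pulse A t, pulse A (t + 1 / 2), sin (2πt), cos (2πt), A)`. -/
abbrev Aux (J : Type) : Type := J ⊕ (J ⊕ Fin 5)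

/-- One of the last five auxiliary unknowns. -/
noncomputable def clock (i : Fin 5) : MvPolynomial (Fin 4 ⊕ Aux J) ℝ := X (.inr (.inr (.inr i)))

/-- The vector field for the sampled readouts. -/
noncomputable def sampleField (j : J) : MvPolynomial (Fin 4 ⊕ Aux J) ℝ :=
  clock 0 * (C (α j) * X (.inl (src j)) + C (β j) - X (.inr (.inl j)))

/-- The polynomial vector field of the simulation. -/
noncomputable def systemField : Fin 4 ⊕ Aux J → MvPolynomial (Fin 4 ⊕ Aux J) ℝ
  | .inl i => clock 1 * (rename (Sum.elim (fun j => .inr (.inl j)) fun j => .inr (.inr (.inl j)))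
      (G i) - X (.inl i))
  | .inr (.inl j) => sampleField src α β j
  -- The chain rule for `sigmoid (A * u)`, from `σ' = σ * (1 - σ)`.
  | .inr (.inr (.inl j)) => X (.inr (.inr (.inl j))) * (1 - X (.inr (.inr (.inl j)))) *
      (clock 4 * sampleField src α β j)
  -- The sign in the second entry arises because a half-period shift negates the cosine. The last
  -- entry keeps `A` constant.
  | .inr (.inr (.inr i)) => (![clock 4 * C (2 * Real.pi) * clock 3 * clock 0,
      -(clock 4 * C (2 * Real.pi) * clock 3 * clock 1), C (2 * Real.pi) * clock 3,
      -(C (2 * Real.pi) * clock 2), 0] : Fin 5 → MvPolynomial (Fin 4 ⊕ Aux J) ℝ) i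

/-- The initial values of the auxiliary unknowns, for the steepness `A`. -/
noncomputable def auxInit (A : ℝ) : Aux J → ℝ :=
  -- The value `2⁻¹` is `sigmoid 0`, as the readouts start at `0`; both pulses start at a zero of
  -- the sine.
  Sum.elim 0 (Sum.elim (fun _ => 2⁻¹)
    ![A ^ 2 * Real.exp (-A), A ^ 2 * Real.exp (-A), 0, 1, A])

/-- The solution of the polynomial system, from that of the sample-and-hold loop. -/
noncomputable def systemCurve (A : ℝ) (z : ℝ → Fin 4 → ℝ) (u : ℝ → J → ℝ) (t : ℝ) :
    Fin 4 ⊕ Aux J → ℝ :=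
  Sum.elim (z t) (Sum.elim (u t) (Sum.elim (fun j => Real.sigmoid (A * u t j))
    ![pulse A t, pulse A (t + 1 / 2), Real.sin (2 * Real.pi * t), Real.cos (2 * Real.pi * t), A]))

variable {src α β G}

theorem isSolution_systemCurve [Fintype J] {A T : ℝ} {z : ℝ → Fin 4 → ℝ} {u : ℝ → J → ℝ}
    {z₀ : Fin 4 → ℝ} (hz0 : z 0 = z₀) (hu0 : u 0 = 0)
    (hz : ∀ t ∈ Icc (0 : ℝ) T, ∀ i, HasDerivWithinAt (fun t => z t i) (pulse A (t + 1 / 2) *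
      (eval (Sum.elim (u t) fun j => Real.sigmoid (A * u t j)) (G i) - z t i)) (Icc 0 T) t)
    (hu : ∀ t ∈ Icc (0 : ℝ) T, ∀ j, HasDerivWithinAt (fun t => u t j) (pulse A t *
      (α j * z t (src j) + β j - u t j)) (Icc 0 T) t) :
    IsSolution (systemField src α β G) (Sum.elim z₀ (auxInit A)) T (systemCurve A z u) := by
  refine ⟨?_, fun t ht => hasDerivWithinAt_pi.2 ?_⟩
  · rw [systemCurve, hz0, hu0, auxInit, pulse_zero, pulse_half]
    simp
  · have hlin : HasDerivAt (fun t : ℝ => 2 * Real.pi * t) (2 * Real.pi) t := by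
      simpa using (hasDerivAt_id t).const_mul (2 * Real.pi)
    rintro (i | j | j | i)
    · have h : (systemCurve A z u t ∘ Sum.elim (fun j => .inr (.inl j))
          fun j => .inr (.inr (.inl j))) = Sum.elim (u t) fun j => Real.sigmoid (A * u t j) := by
        funext k
        rcases k with k | k <;> rfl
      refine (hz t ht i).congr_deriv ?_
      simp only [systemField, clock, map_mul, map_sub, eval_X, eval_rename, h]
      rfl
    · refine (hu t ht j).congr_deriv ?_
      simp [systemField, sampleField, clock, systemCurve]
    · have h := (Real.hasDerivAt_sigmoid (A * u t j)).comp_hasDerivWithinAt t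
        ((hu t ht j).const_mul A)
      refine h.congr_deriv ?_
      simp [systemField, sampleField, clock, systemCurve]
    · fin_cases i
      · refine (hasDerivAt_pulse A t).hasDerivWithinAt.congr_deriv ?_
        simp [systemField, clock, systemCurve]
      · have h := (hasDerivAt_pulse A (t + 1 / 2)).comp t ((hasDerivAt_id t).add_const (1 / 2))
        refine h.hasDerivWithinAt.congr_deriv ?_
        rw [show 2 * Real.pi * (t + 1 / 2) = 2 * Real.pi * t + Real.pi by ring, Real.cos_add_pi]
        simp [systemField, clock, systemCurve]
      · refine hlin.sin.hasDerivWithinAt.congr_deriv ?_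
        simp [systemField, clock, systemCurve, mul_comm]
      · refine hlin.cos.hasDerivWithinAt.congr_deriv ?_
        simp [systemField, clock, systemCurve, mul_comm]
      · refine (hasDerivWithinAt_const t _ A).congr_deriv ?_
        simp [systemField]

theorem norm_systemCurve_le [Fintype J] {A R t : ℝ} {z : ℝ → Fin 4 → ℝ} {u : ℝ → J → ℝ}
    (hA : 0 ≤ A) (hz : ∀ i, |z t i| ≤ R) (hu : ∀ j, |u t j| ≤ R) (hR : 0 ≤ R) :
    ‖systemCurve A z u t‖ ≤ R + 1 + A + A ^ 2 := by
  have hA2 : 0 ≤ A ^ 2 := sq_nonneg A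
  rw [pi_norm_le_iff_of_nonneg (by positivity)]
  rintro (i | j | j | i) <;> rw [Real.norm_eq_abs]
  · exact (hz i).trans (by linarith)
  · exact (hu j).trans (by linarith)
  · change |Real.sigmoid (A * u t j)| ≤ _
    rw [abs_of_pos (Real.sigmoid_pos _)]
    linarith [Real.sigmoid_le_one (A * u t j)]
  · fin_cases i
    · change |pulse A t| ≤ _
      rw [abs_of_nonneg (pulse_nonneg A t)]
      linarith [pulse_le hA t]
    · change |pulse A (t + 1 / 2)| ≤ _
      rw [abs_of_nonneg (pulse_nonneg A _)]
      linarith [pulse_le hA (t + 1 / 2)]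
    · change |Real.sin (2 * Real.pi * t)| ≤ _
      linarith [Real.abs_sin_le_one (2 * Real.pi * t)]
    · change |Real.cos (2 * Real.pi * t)| ≤ _
      linarith [Real.abs_cos_le_one (2 * Real.pi * t)]
    · change |A| ≤ _
      rw [abs_of_nonneg hA]
      linarith

theorem auxInit_simple (D : ℝ) (k : Aux J) : ∃ a b : MvPolynomial (Fin 2) ℝ, ∀ S T : ℝ,
    auxInit (D * (S + T + 1)) k = eval ![S, T] a * Real.exp (eval ![S, T] b) := by
  set P : MvPolynomial (Fin 2) ℝ := C D * (X 0 + X 1 + 1) with hP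
  have hPe : ∀ S T : ℝ, eval ![S, T] P = D * (S + T + 1) := fun S T => by simp [hP]
  rcases k with j | j | i
  · exact ⟨0, 0, fun S T => by simp [auxInit]⟩
  · exact ⟨C 2⁻¹, 0, fun S T => by simp [auxInit]⟩
  · fin_cases i
    · exact ⟨P ^ 2, -P, fun S T => by simp [auxInit, hPe]⟩
    · exact ⟨P ^ 2, -P, fun S T => by simp [auxInit, hPe]⟩
    · exact ⟨0, 0, fun S T => by simp [auxInit]⟩
    · exact ⟨1, 0, fun S T => by simp [auxInit]⟩
    · exact ⟨P, 0, fun S T => by simp [auxInit, hPe]⟩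

end System

/-- A steepness that is linear in space and time beats all exponential error terms. -/
theorem exists_steepness {κ K k : ℝ} (hκ : 0 < κ) (hK : 1 ≤ K) (hk : 1 ≤ k) :
    ∃ D ≥ 1, ∀ (S N : ℕ) (T : ℝ), 0 ≤ T → (N : ℝ) ≤ T + 1 →
      K ^ (N + 1) * ((D * (S + T + 1)) ^ 2 * Real.exp (-(κ * (D * (S + T + 1))))) ≤
        1 / (4 * k ^ S) := by
  -- Half of the exponent `κ * A` absorbs `A ^ 2`, at the cost of `8 / κ ^ 2`; with the factor `4`
  -- this gives `32 / κ ^ 2`. The other half must beat `w ^ (N + S + 2)`, and `N + S + 2 ≤ 3 * (S +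
  -- T + 1)` explains the `6 * w / κ` in `D`.
  set w := K + k + 32 / κ ^ 2 with hw
  have hc : 0 < 32 / κ ^ 2 := by positivity
  have hw1 : 1 ≤ w := by linarith
  refine ⟨6 * w / κ + 1, by have : 0 ≤ 6 * w / κ := by positivity
                            linarith, fun S N T hT hN => ?_⟩
  set A := (6 * w / κ + 1) * (S + T + 1) with hA
  have hST : 0 ≤ (S : ℝ) + T + 1 := by positivity
  have hA0 : 0 ≤ A := by positivity
  have hκA : 3 * w * (S + T + 1) ≤ κ * A / 2 := by
    have h1 : κ * A / 2 = 3 * w * (S + T + 1) + κ / 2 * (S + T + 1) := by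
      rw [hA]
      field_simp
      ring
    rw [h1]
    have : 0 ≤ κ / 2 * ((S : ℝ) + T + 1) := by positivity
    linarith
  have hsq : A ^ 2 ≤ 8 / κ ^ 2 * Real.exp (κ * A / 2) := by
    have h1 := Real.quadratic_le_exp_of_nonneg (x := κ * A / 2) (by positivity)
    have h2 : (κ * A / 2) ^ 2 / 2 ≤ Real.exp (κ * A / 2) := by
      have : 0 ≤ κ * A / 2 := by positivity
      linarith
    calc A ^ 2 = 8 / κ ^ 2 * ((κ * A / 2) ^ 2 / 2) := by field_simp; ring
      _ ≤ _ := by gcongr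
  have hpow : w ^ (N + 1 + S + 1) ≤ Real.exp (κ * A / 2) := by
    calc w ^ (N + 1 + S + 1) ≤ Real.exp w ^ (N + 1 + S + 1) := by
          gcongr
          linarith [Real.add_one_le_exp w]
      _ = Real.exp ((N + 1 + S + 1 : ℕ) * w) := (Real.exp_nat_mul _ _).symm
      _ ≤ _ := by
          apply Real.exp_le_exp.2
          refine le_trans ?_ hκA
          push_cast
          have hS : (0 : ℝ) ≤ S := S.cast_nonneg
          nlinarith
  have hprod : K ^ (N + 1) * (32 / κ ^ 2) * k ^ S ≤ w ^ (N + 1 + S + 1) := by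
    have h1 : K ^ (N + 1) ≤ w ^ (N + 1) := by gcongr; linarith
    have h2 : k ^ S ≤ w ^ S := by gcongr; linarith
    have h3 : 32 / κ ^ 2 ≤ w := by linarith
    calc K ^ (N + 1) * (32 / κ ^ 2) * k ^ S ≤ w ^ (N + 1) * w * w ^ S := by gcongr
      _ = _ := by rw [pow_succ w (N + 1 + S), pow_add w (N + 1) S]; ring
  rw [le_div_iff₀ (by positivity)]
  calc K ^ (N + 1) * (A ^ 2 * Real.exp (-(κ * A))) * (4 * k ^ S)
      ≤ K ^ (N + 1) * (8 / κ ^ 2 * Real.exp (κ * A / 2) * Real.exp (-(κ * A))) * (4 * k ^ S) := by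
        gcongr
    _ = K ^ (N + 1) * (32 / κ ^ 2) * k ^ S * Real.exp (-(κ * A / 2)) := by
        rw [mul_assoc (8 / κ ^ 2), ← Real.exp_add, show κ * A / 2 + -(κ * A) = -(κ * A / 2) by ring]
        ring
    _ ≤ Real.exp (κ * A / 2) * Real.exp (-(κ * A / 2)) := by
        gcongr
        exact hprod.trans hpow
    _ = 1 := by rw [← Real.exp_add, add_neg_cancel, Real.exp_zero]

end GPACSim

/-- For every machine `M` there are a vector of polynomials `p` in `4 + m` unknowns, a simple
encoding `ψ` of the parameters and a polynomial `P` such that, started from the rational encoding of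
the initial configuration on `e` together with `ψ(S, T)`, the equation `y' = p(y)` has exactly one
solution on `[0, T]`, the first four coordinates of which describe the configuration of `M` after
`n` steps at every integer time `n ≤ T`, and which is bounded by `P(S + T)`. -/
theorem mainTheorem1 (M : GPACSim.Machine) :
    ∃ (m : ℕ) (p : Fin 4 ⊕ Fin m → MvPolynomial (Fin 4 ⊕ Fin m) ℝ)
      (ψ : ℝ → ℝ → Fin m → ℝ) (P : Polynomial ℝ),
      GPACSim.IsSimple ψ ∧
      ∀ (e : List M.Symbol) (T : ℝ) (S : ℕ), 0 ≤ T → M.RunsInSpace e T S →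
        ∃ y : ℝ → (Fin 4 ⊕ Fin m) → ℝ,
          GPACSim.IsSolution p (Sum.elim (M.encode (M.init e)) (ψ S T)) T y ∧
          (∀ z : ℝ → (Fin 4 ⊕ Fin m) → ℝ,
            GPACSim.IsSolution p (Sum.elim (M.encode (M.init e)) (ψ S T)) T z →
              Set.EqOn z y (Set.Icc 0 T)) ∧
          (∀ n : ℕ, (n : ℝ) ≤ T →
            M.Describes S (fun i => y n (Sum.inl i)) (M.run e n)) ∧
          (∀ t ∈ Set.Icc 0 T, ‖y t‖ ≤ P.eval ((S : ℝ) + T)) := by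
  open GPACSim in
  obtain ⟨κ, hκ, K, hK, R, hR, hloop⟩ := exists_loop M.readoutSource M.readoutSlope
    M.readoutOffset M.update M.step M.encode (by positivity) M.abs_encode_le (by positivity)
    M.le_abs_readout M.eval_update
  have hbase : 1 ≤ (M.base : ℝ) := by
    exact_mod_cast (by unfold Machine.base; omega : 1 ≤ M.base)
  obtain ⟨D, hD, hsteep⟩ := exists_steepness hκ hK hbase
  set aux := Aux M.Readout
  set e := Fintype.equivFin aux
  set ι := Equiv.sumCongr (Equiv.refl (Fin 4)) e with hι
  -- At `S + T` this polynomial takes the value `A`.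
  set Q : Polynomial ℝ := Polynomial.C D * (Polynomial.X + 1) with hQ
  refine ⟨Fintype.card aux, fun i => MvPolynomial.rename ι
    (systemField M.readoutSource M.readoutSlope M.readoutOffset M.update (ι.symm i)),
    fun S T k => auxInit (D * (S + T + 1)) (e.symm k),
    Polynomial.C (R + 1) + Q + Q ^ 2, fun k => auxInit_simple D (e.symm k), ?_⟩
  intro inp T S hT hspace
  set A := D * ((S : ℝ) + T + 1) with hAdef
  have hA1 : 1 ≤ A := one_le_mul_of_one_le_of_one_le hD (by
    have : (0 : ℝ) ≤ S := S.cast_nonneg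
    linarith)
  -- The loop runs for whole units of time, so it is continued to an integer beyond `T`.
  set N := ⌊T⌋₊ + 1 with hN
  have hNT : T ≤ N := by
    rw [hN]
    push_cast
    exact (Nat.lt_floor_add_one T).le
  have hNT' : (N : ℝ) ≤ T + 1 := by
    rw [hN]
    push_cast
    linarith [Nat.floor_le hT]
  have hkS : 1 ≤ (M.base : ℝ) ^ S := one_le_pow₀ hbase
  have hsmall := hsteep S N T hT hNT'
  have hsmall1 : 1 / (4 * (M.base : ℝ) ^ S) ≤ 1 := by
    rw [div_le_one (by positivity)]
    linarith
  obtain ⟨z, u, hz0, hu0, hz, hu, hbd, herr⟩ := hloop A hA1 N (hsmall.trans hsmall1) (M.init inp)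
  have hsub : Set.Icc (0 : ℝ) T ⊆ Set.Icc 0 N := Set.Icc_subset_Icc_right hNT
  have hsol := (isSolution_systemCurve (T := T) hz0 hu0
    (fun t ht i => (hz t (hsub ht) i).mono hsub)
    (fun t ht j => (hu t (hsub ht) j).mono hsub)).reindex ι
  have hinit : Sum.elim (M.encode (M.init inp)) (auxInit A) ∘ ι.symm =
      Sum.elim (M.encode (M.init inp)) fun k => auxInit A (e.symm k) := by
    funext k
    rcases k with k | k <;> rfl
  rw [hinit] at hsol
  refine ⟨_, hsol, fun y hy => hy.eqOn hsol, fun n hn => ?_, fun t ht => ?_⟩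
  · have hnN : n ≤ N := by exact_mod_cast hn.trans hNT
    refine M.describes_of_norm_sub_le (hspace n hn)
      ((pi_norm_le_iff_of_nonneg (by positivity)).2 fun i => ?_)
    refine (herr n hnN i).trans (le_trans ?_ hsmall)
    gcongr
    omega
  · have h := norm_systemCurve_le (A := A) (z := z) (u := u) (t := t) (by linarith)
      (hbd t (hsub ht)).1 (hbd t (hsub ht)).2 hR
    have hnn := (norm_nonneg _).trans h
    rw [pi_norm_le_iff_of_nonneg hnn] at h
    have hev : (Polynomial.C (R + 1) + Q + Q ^ 2).eval ((S : ℝ) + T) = R + 1 + A + A ^ 2 := by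
      simp [hQ, hAdef]
    rw [hev, pi_norm_le_iff_of_nonneg hnn]
    exact fun i => h (ι.symm i)
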